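/- Let $p$ be any prime and $n \ge 0$ an integer, and let $P_n$ be a Sylow $p$-subgroup of the symmetric group $S_{p^n}$. Then there is a Hall $p'$-subgroup $H$ of the normalizer $N_{S_{p^n}}(P_n)$ (that is, $|H|$ is prime to $p$ and $|N_{S_{p^n}}(P_n):H|$ is a power of $p$), isomorphic to $(C_{p-1})^n$, with the following property: every normal subgroup $N \trianglelefteq P_n$ which has a complement in $P_n$, whether or not $N$ is itself $H$-invariant, has an $H$-invariant complement in $P_n$ (i.e. there is $C \le P_n$ with $NC = P_n$, $N \cap C = 1$ and $hCh^{-1} = C$ for all $h \in H$). More explicitly, identify $S_{p^n}$ with $\operatorname{Sym}(\mathbb{F}_p^n)$. For $0 \le i \le n-1$ let $\sigma_i$ be the permutation of $\mathbb{F}_p^n$ that sends $(\lambda_0,\ldots,\lambda_{n-1})$ to $(\lambda_0,\ldots,\lambda_i+1,\ldots,\lambda_{n-1})$ if $\lambda_j = 0$ for all $j<i$, and fixes it otherwise. Let $r$ be any generator of $\mathbb{F}_p^\times$, and let $\eta_i$ be the permutation $(\lambda_0,\ldots,\lambda_{n-1}) \mapsto (\lambda_0,\ldots,r\lambda_i,\ldots,\lambda_{n-1})$.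 Then $P_n := \langle \sigma_0,\ldots,\sigma_{n-1}\rangle$ is a Sylow $p$-subgroup of $\operatorname{Sym}(\mathbb{F}_p^n)$, the group $H := \langle \eta_0,\ldots,\eta_{n-1}\rangle \cong (C_{p-1})^n$ is a Hall $p'$-subgroup of the normalizer of $P_n$ in $\operatorname{Sym}(\mathbb{F}_p^n)$, and every normal subgroup of $P_n$ which has a complement in $P_n$ has an $H$-invariant complement in $P_n$. -/

import Mathlib

namespace MaschkeSym

/-- The permutation `σ_i` of `𝔽_p ^ n`: it adds `1` to the coordinate `λ_i` of a vector
`(λ_0, …, λ_{n-1})` all of whose earlier coordinates `λ_j`, `j < i`, vanish, and it fixes every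
other vector. -/
def sigmaPerm (p n : ℕ) (i : Fin n) : Equiv.Perm (Fin n → ZMod p) where
  toFun v := if ∀ j < i, v j = 0 then Function.update v i (v i + 1) else v
  invFun v := if ∀ j < i, v j = 0 then Function.update v i (v i - 1) else v
  left_inv v := by
    by_cases h : ∀ j < i, v j = 0
    · have h' : ∀ j < i, Function.update v i (v i + 1) j = 0 := fun j hj => by
        rw [Function.update_of_ne hj.ne]; exact h j hj
      simp [if_pos h, if_pos h']
    · simp [if_neg h]
  right_inv v := by
    by_cases h : ∀ j < i, v j = 0
    · have h' : ∀ j < i, Function.update v i (v i - 1) j = 0 := fun j hj => by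
        rw [Function.update_of_ne hj.ne]; exact h j hj
      simp [if_pos h, if_pos h']
    · simp [if_neg h]

/-- The permutation `η_i` of `𝔽_p ^ n`: it multiplies the coordinate `λ_i` by the unit `r`. -/
def etaPerm (p n : ℕ) (r : (ZMod p)ˣ) (i : Fin n) : Equiv.Perm (Fin n → ZMod p) where
  toFun v := Function.update v i (r * v i)
  invFun v := Function.update v i ((r⁻¹ : (ZMod p)ˣ) * v i)
  left_inv v := by simp
  right_inv v := by simp

/-- `P_n = ⟨σ_0, …, σ_{n-1}⟩`, the iterated wreath product in `Sym(𝔽_p ^ n)`. -/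
def sigmaGroup (p n : ℕ) : Subgroup (Equiv.Perm (Fin n → ZMod p)) :=
  Subgroup.closure (Set.range (sigmaPerm p n))

/-- `H = ⟨η_0, …, η_{n-1}⟩`. -/
def etaGroup (p n : ℕ) (r : (ZMod p)ˣ) : Subgroup (Equiv.Perm (Fin n → ZMod p)) :=
  Subgroup.closure (Set.range (etaPerm p n r))

/-- `H` is a Hall `p'`-subgroup of the group `G`: its order is prime to `p`, and its index is a
power of `p`. (No subgroup of an infinite `G` satisfies both.) -/
def IsHallPrimeTo (p : ℕ) {G : Type*} [Group G] (H : Subgroup G) : Prop :=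
  (Nat.card H).Coprime p ∧ ∃ k : ℕ, H.index = p ^ k

/-- Inside an ambient group `G`, the subgroup `H` is contained in the subgroup `K` and is a Hall
`p'`-subgroup of `K`. -/
def IsHallPrimeToIn (p : ℕ) {G : Type*} [Group G] (H K : Subgroup G) : Prop :=
  H ≤ K ∧ IsHallPrimeTo p (H.subgroupOf K)

/-- The subgroup `C` is invariant under conjugation by all elements of `H`. -/
def IsConjInvariant {G : Type*} [Group G] (H C : Subgroup G) : Prop :=
  ∀ h ∈ H, ∀ c ∈ C, h * c * h⁻¹ ∈ C

/-- Every normal subgroup `N` of `P` that has a complement in `P` has a complement in `P` that is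
`H`-invariant. The subgroup `N` itself need not be `H`-invariant. -/
def ComplementsCanBeInvariant {G : Type*} [Group G] (H P : Subgroup G) : Prop :=
  ∀ N : Subgroup P, N.Normal → (∃ L : Subgroup P, N.IsComplement' L) →
    ∃ C : Subgroup P, N.IsComplement' C ∧ IsConjInvariant H (C.map P.subtype)

end MaschkeSym

/-!
The group `P = ⟨σ_0, …, σ_{n-1}⟩` consists of all triangular permutations
`v_k ↦ v_k + f_k (v_0, …, v_{k-1})` of `𝔽_p ^ n` (`sigmaGroup_eq_triGroup`). It contains all
translations, and an element of its normalizer acts on each coordinate by an affine map with linear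
part independent of the earlier coordinates (`affine_of_mem_normalizer`). So the normalizer is the
product of `P` with the group `H` of the diagonal matrices, whose order `(p - 1) ^ n` is prime to
`p`; this gives the Hall property, and, since the index of `P` in its normalizer is congruent modulo
`p` to its index in the symmetric group, also the Sylow property.

Let `K_i` be the kernel of the action of `P` on the first `i` coordinates. Its abelianization is the
map `psiFamily i` to the families, indexed by the levels `j ≥ i`, of functions on the set `𝔽_p ^ i`
of prefixes: one sums the displacements of the `j`-th coordinate over all prefixes of length `j`
that extend a given prefix of length `i` (`mem_commutator_of_psi_eq_zero`). If `N ≠ 1` is normal in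
`P` and `i` is the largest number with `N ≤ K_i`, then `N` contains an element translating the
`i`-th coordinate, and it follows that `N` contains the commutator subgroup of `K_i`
(`commutator_levelKer_le`). Thus `N` is determined by its image `U` in the abelianization, a
subspace invariant under translations of the prefixes. If `L` is a complement of `N`, the image `D`
of `L ∩ K_i` is an invariant complement of `U`. As every non-zero invariant subspace contains
non-zero constants, a comparison of dimensions shows that `U` has even a complement consisting of
all families supported on a set `S` of levels, and for `S` one can take any set whose coordinate
subspace complements the constants of `U` (`isCompl_supportedOn_of_const`).

It remains to lift the coordinate subspace of `S` to an `H`-invariant abelian subgroup of `K_i`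
normalized by the action on the first `i` coordinates. To this end the `k`-th coordinate, `k ∈ S`,
is only moved where the first vanishing coordinate from the `i`-th on is the one before the `k`-th
(`FirstZero`). These conditions are invariant under diagonal matrices, they cut out a number of
prefixes that is prime to `p`, and they exclude each other for different `k > i`, so that one gets a
complement as soon as `i ∉ S` or `|S| ≤ 1` (`standardComplement`). Such an `S` exists
(`exists_coordinates`): otherwise no constant in `U` involves the `i`-th level, some element of
`L ∩ K_i` translates the `i`-th coordinate, and as this group is abelian the constants of `D` are
at most one-dimensional (`psi_eq_zero_of_commute`).
-/

namespace MaschkeSym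

open Equiv
open scoped commutatorElement

variable {p n : ℕ}

/-! ### Triangular permutations -/

/-- The vectors `v` and `w` have the same coordinates `v k = w k` for `k < i`. -/
def Agree (i : ℕ) (v w : Fin n → ZMod p) : Prop := ∀ k : Fin n, (k : ℕ) < i → v k = w k

/-- The value `f v` depends only on the coordinates `v k` with `k < i`. -/
def DependsBelow (i : ℕ) (f : (Fin n → ZMod p) → ZMod p) : Prop :=
  ∀ v w, Agree i v w → f v = f w

lemma Agree.refl (i : ℕ) (v : Fin n → ZMod p) : Agree i v v := fun _ _ => rfl

lemma Agree.symm {i : ℕ} {v w : Fin n → ZMod p} (h : Agree i v w) : Agree i w v :=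
  fun k hk => (h k hk).symm

lemma Agree.trans {i : ℕ} {u v w : Fin n → ZMod p} (h : Agree i u v) (h' : Agree i v w) :
    Agree i u w :=
  fun k hk => (h k hk).trans (h' k hk)

lemma Agree.mono {i j : ℕ} {v w : Fin n → ZMod p} (h : Agree j v w) (hij : i ≤ j) :
    Agree i v w :=
  fun k hk => h k (hk.trans_le hij)

lemma Agree.succ {i : Fin n} {v w : Fin n → ZMod p} (h : Agree i v w) (h' : v i = w i) :
    Agree (i + 1) v w := by
  intro k hk
  rcases (Nat.lt_succ_iff.mp hk).lt_or_eq with hk | hk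
  · exact h k hk
  · rw [Fin.ext hk, h']

lemma Agree.eq {i : ℕ} {v w : Fin n → ZMod p} (h : Agree i v w) (hi : n ≤ i) : v = w :=
  funext fun k => h k (k.2.trans_le hi)

lemma agree_add_single (v : Fin n → ZMod p) (i : Fin n) (c : ZMod p) :
    Agree i (v + Pi.single i c) v := by
  intro k hk
  have : k ≠ i := fun h => by simp [h] at hk
  simp [this]

lemma DependsBelow.add {j : ℕ} {f g : (Fin n → ZMod p) → ZMod p} (hf : DependsBelow j f)
    (hg : DependsBelow j g) : DependsBelow j (f + g) :=
  fun v w h => by simp [hf v w h, hg v w h]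

lemma DependsBelow.neg {j : ℕ} {f : (Fin n → ZMod p) → ZMod p} (hf : DependsBelow j f) :
    DependsBelow j (-f) :=
  fun v w h => by simp [hf v w h]

lemma DependsBelow.zero (j : ℕ) : DependsBelow j (0 : (Fin n → ZMod p) → ZMod p) :=
  fun _ _ _ => rfl

lemma DependsBelow.const (j : ℕ) (c : ZMod p) :
    DependsBelow j (fun _ : Fin n → ZMod p => c) :=
  fun _ _ _ => rfl

lemma DependsBelow.translate {j : ℕ} {f : (Fin n → ZMod p) → ZMod p} (hf : DependsBelow j f)
    (a : Fin n → ZMod p) : DependsBelow j fun v => f (v - a) :=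
  fun _ _ h => hf _ _ fun k hk => by simp [h k hk]

lemma agree_of_displacement {g : (Fin n → ZMod p) → (Fin n → ZMod p)}
    (hg : ∀ k : Fin n, DependsBelow k fun v => g v k - v k) {i : ℕ} {v w : Fin n → ZMod p} :
    Agree i (g v) (g w) ↔ Agree i v w := by
  constructor
  · intro h
    suffices ∀ j : ℕ, ∀ k : Fin n, (k : ℕ) = j → j < i → v k = w k from
      fun k hk => this k k rfl hk
    intro j
    induction j using Nat.strong_induction_on with
    | _ j ih =>
      intro k hkj hji
      have h1 : Agree k v w := fun l hl => ih l (hkj ▸ hl) l rfl (by omega)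
      have h2 := hg k v w h1
      have h3 := h k (by omega)
      simp only [h3] at h2
      exact sub_right_injective h2
  · intro h k hk
    have h2 := hg k v w (h.mono hk.le)
    simp only [h k hk] at h2
    exact sub_left_injective h2

/-- The group of all permutations of `𝔽_p ^ n` of the form `v_k ↦ v_k + f_k (v_0, …, v_{k-1})`
(Kaloujnine's tableaux). -/
def triGroup (p n : ℕ) : Subgroup (Perm (Fin n → ZMod p)) where
  carrier := {g | ∀ k : Fin n, DependsBelow k fun v => g v k - v k}
  one_mem' := by intro k v w _; simp
  mul_mem' := by
    intro g h hg hh k v w hvw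
    have h1 := hg k (h v) (h w) ((agree_of_displacement hh).2 hvw)
    have h2 := hh k v w hvw
    simp only [Perm.mul_apply] at *
    linear_combination h1 + h2
  inv_mem' := by
    intro g hg k v w hvw
    have h0 : Agree k (g⁻¹ v) (g⁻¹ w) := by
      rw [← agree_of_displacement hg]; simpa using hvw
    have h1 := hg k _ _ h0
    have h2 : ∀ u, g (g⁻¹ u) = u := fun u => g.apply_symm_apply u
    simp only [h2] at h1
    linear_combination -h1

lemma agree_apply_iff {g : Perm (Fin n → ZMod p)} (hg : g ∈ triGroup p n) {i : ℕ}
    {v w : Fin n → ZMod p} : Agree i (g v) (g w) ↔ Agree i v w :=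
  agree_of_displacement hg

/-- The subgroup of the triangular permutations that fix the first `i` coordinates of every
vector. -/
def levelKer (p n i : ℕ) : Subgroup (Perm (Fin n → ZMod p)) where
  carrier := {g | g ∈ triGroup p n ∧ ∀ v, Agree i (g v) v}
  one_mem' := ⟨one_mem _, fun v => Agree.refl i v⟩
  mul_mem' := by
    rintro g h ⟨hg, hg'⟩ ⟨hh, hh'⟩
    exact ⟨mul_mem hg hh, fun v => (hg' (h v)).trans (hh' v)⟩
  inv_mem' := by
    rintro g ⟨hg, hg'⟩
    refine ⟨inv_mem hg, fun v => ?_⟩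
    simpa using (hg' (g⁻¹ v)).symm

lemma levelKer_le (i : ℕ) : levelKer p n i ≤ triGroup p n := fun _ h => h.1

lemma levelKer_zero : levelKer p n 0 = triGroup p n :=
  le_antisymm (levelKer_le 0) fun _ h => ⟨h, fun _ k hk => absurd hk (by omega)⟩

lemma eq_one_of_mem_levelKer {i : ℕ} (hi : n ≤ i) {g : Perm (Fin n → ZMod p)}
    (hg : g ∈ levelKer p n i) : g = 1 :=
  Equiv.ext fun v => (hg.2 v).eq hi

lemma levelKer_anti {i j : ℕ} (hij : i ≤ j) : levelKer p n j ≤ levelKer p n i :=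
  fun _ h => ⟨h.1, fun v => (h.2 v).mono hij⟩

lemma conj_mem_levelKer {i : ℕ} {g k : Perm (Fin n → ZMod p)} (hg : g ∈ triGroup p n)
    (hk : k ∈ levelKer p n i) : g * k * g⁻¹ ∈ levelKer p n i := by
  refine ⟨mul_mem (mul_mem hg hk.1) (inv_mem hg), fun v => ?_⟩
  have := (agree_apply_iff hg).2 (hk.2 (g⁻¹ v))
  simpa using this

lemma mem_levelKer_succ {i : Fin n} {g : Perm (Fin n → ZMod p)} (hg : g ∈ levelKer p n i)
    (h : ∀ v, g v i = v i) : g ∈ levelKer p n (i + 1) :=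
  ⟨hg.1, fun v => (hg.2 v).succ (h v)⟩

/-- An element of `levelKer p n i` displaces the `i`-th coordinate by a function that is constant
along its orbits. -/
lemma pow_apply_level {i : Fin n} {g : Perm (Fin n → ZMod p)} (hg : g ∈ levelKer p n i) (m : ℕ)
    (v : Fin n → ZMod p) : (g ^ m) v i = v i + m * (g v i - v i) := by
  induction m with
  | zero => simp
  | succ m ih =>
    have h : g ((g ^ m) v) i - (g ^ m) v i = g v i - v i :=
      hg.1 i ((g ^ m) v) v ((pow_mem hg m).2 v)
    rw [pow_succ', Perm.mul_apply]
    push_cast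
    linear_combination h + ih

section Constructions

/-- The map `v ↦ v + f v` as a permutation, when the `k`-th coordinate of `f v` depends only on
the coordinates of `v` before the `k`-th. -/
noncomputable def triPerm [NeZero p] (f : Fin n → (Fin n → ZMod p) → ZMod p)
    (hf : ∀ k : Fin n, DependsBelow k (f k)) : Perm (Fin n → ZMod p) :=
  Equiv.ofBijective (fun v k => v k + f k v) <| Finite.injective_iff_bijective.mp <| by
    have hg : ∀ k : Fin n, DependsBelow k
        fun v => (fun (v : Fin n → ZMod p) k => v k + f k v) v k - v k := by
      intro k v w hvw
      simpa using hf k v w hvw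
    intro v w hvw
    exact ((agree_of_displacement hg (i := n)).1 fun k _ => congrFun hvw k).eq le_rfl

@[simp] lemma triPerm_apply [NeZero p] (f : Fin n → (Fin n → ZMod p) → ZMod p)
    (hf : ∀ k : Fin n, DependsBelow k (f k)) (v : Fin n → ZMod p) (k : Fin n) :
    triPerm f hf v k = v k + f k v := rfl

lemma triPerm_mem [NeZero p] (f : Fin n → (Fin n → ZMod p) → ZMod p)
    (hf : ∀ k : Fin n, DependsBelow k (f k)) : triPerm f hf ∈ triGroup p n := by
  intro k v w hvw
  simpa using hf k v w hvw

/-- The elementary permutation that adds `f v` to the `j`-th coordinate of `v`; it is bijective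
because `f` depends on the coordinates before the `j`-th alone. -/
noncomputable def levelPerm [NeZero p] (j : Fin n) (f : (Fin n → ZMod p) → ZMod p)
    (hf : DependsBelow j f) : Perm (Fin n → ZMod p) :=
  triPerm (fun k => if k = j then f else 0) <| by
    intro k
    split_ifs with h
    · rwa [h]
    · exact DependsBelow.zero _

lemma levelPerm_apply [NeZero p] (j : Fin n) (f : (Fin n → ZMod p) → ZMod p)
    (hf : DependsBelow j f) (v : Fin n → ZMod p) :
    levelPerm j f hf v = v + Pi.single j (f v) := by
  funext k
  by_cases h : k = j
  · subst h; simp [levelPerm]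
  · simp [levelPerm, h]

lemma levelPerm_mem_levelKer [NeZero p] {i : ℕ} {j : Fin n} (hij : i ≤ j)
    (f : (Fin n → ZMod p) → ZMod p) (hf : DependsBelow j f) :
    levelPerm j f hf ∈ levelKer p n i :=
  ⟨triPerm_mem _ _, fun v => by
    rw [levelPerm_apply]; exact (agree_add_single v j _).mono hij⟩

lemma levelPerm_mem [NeZero p] (j : Fin n)
    (f : (Fin n → ZMod p) → ZMod p) (hf : DependsBelow j f) :
    levelPerm j f hf ∈ triGroup p n := triPerm_mem _ _

lemma levelPerm_mul [NeZero p] (j : Fin n) {f g : (Fin n → ZMod p) → ZMod p}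
    (hf : DependsBelow j f) (hg : DependsBelow j g) :
    levelPerm j f hf * levelPerm j g hg = levelPerm j (f + g) (hf.add hg) := by
  ext1 v
  rw [Perm.mul_apply, levelPerm_apply, levelPerm_apply, levelPerm_apply,
    hf _ v (agree_add_single v j _), add_assoc, ← Pi.single_add, add_comm (g v)]
  rfl

lemma addRight_mem_triGroup (a : Fin n → ZMod p) : Equiv.addRight a ∈ triGroup p n := by
  intro k v w _
  simp

lemma addRight_mem_levelKer {i : ℕ} {a : Fin n → ZMod p} (ha : Agree i a 0) :
    Equiv.addRight a ∈ levelKer p n i :=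
  ⟨addRight_mem_triGroup a, fun v k hk => by simp [ha k hk]⟩

lemma addRight_conj_levelPerm [NeZero p] (a : Fin n → ZMod p) (j : Fin n)
    (f : (Fin n → ZMod p) → ZMod p) (hf : DependsBelow j f) :
    Equiv.addRight a * levelPerm j f hf * (Equiv.addRight a)⁻¹ =
      levelPerm j (fun v => f (v - a)) (hf.translate a) := by
  ext1 v
  have h1 : (Equiv.addRight a)⁻¹ v = v - a := by
    rw [Perm.inv_eq_iff_eq]; simp
  rw [Perm.mul_apply, Perm.mul_apply, h1, levelPerm_apply, levelPerm_apply, Equiv.coe_addRight]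
  exact (add_right_comm _ _ _).trans (by rw [sub_add_cancel])

/-- The functions `f` for which the elementary permutation adding `f v` to the `j`-th coordinate
of `v` exists and belongs to `S`. -/
def levelPreimage [NeZero p] (S : Subgroup (Perm (Fin n → ZMod p))) (j : Fin n) :
    AddSubgroup ((Fin n → ZMod p) → ZMod p) where
  carrier := {f | ∃ hf : DependsBelow j f, levelPerm j f hf ∈ S}
  zero_mem' := by
    refine ⟨DependsBelow.zero _, ?_⟩
    convert one_mem S
    ext1 v
    simp [levelPerm_apply]
  add_mem' := by
    rintro f g ⟨hf, hfS⟩ ⟨hg, hgS⟩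
    exact ⟨hf.add hg, by rw [← levelPerm_mul j hf hg]; exact S.mul_mem hfS hgS⟩
  neg_mem' := by
    rintro f ⟨hf, hfS⟩
    refine ⟨hf.neg, ?_⟩
    convert S.inv_mem hfS
    rw [eq_inv_iff_mul_eq_one, levelPerm_mul]
    ext1 v
    simp [levelPerm_apply]

lemma mem_levelPreimage [NeZero p] {S : Subgroup (Perm (Fin n → ZMod p))} {j : Fin n}
    {f : (Fin n → ZMod p) → ZMod p} :
    f ∈ levelPreimage S j ↔ ∃ hf : DependsBelow j f, levelPerm j f hf ∈ S := Iff.rfl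

end Constructions

/-- The vector that has the first `j` coordinates of `v` and vanishes elsewhere. -/
def trunc (j : ℕ) (v : Fin n → ZMod p) : Fin n → ZMod p := fun k => if (k : ℕ) < j then v k else 0

lemma agree_trunc (j : ℕ) (v : Fin n → ZMod p) : Agree j (trunc j v) v :=
  fun k hk => by simp [trunc, hk]

lemma trunc_apply_of_le {j : ℕ} (v : Fin n → ZMod p) {k : Fin n} (hk : j ≤ k) :
    trunc j v k = 0 := by simp [trunc, hk.not_gt]

lemma trunc_congr {j : ℕ} {v w : Fin n → ZMod p} (h : Agree j v w) : trunc j v = trunc j w := by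
  funext k
  by_cases hk : (k : ℕ) < j <;> simp [trunc, hk]
  exact h k hk

lemma trunc_eq_self {j : ℕ} {v : Fin n → ZMod p} (h : ∀ k : Fin n, j ≤ k → v k = 0) :
    trunc j v = v := by
  funext k
  by_cases hk : (k : ℕ) < j <;> simp [trunc, hk]
  exact (h k (not_lt.1 hk)).symm

/-- The indicator function of the set of all vectors that agree with `y` below `j`. -/
noncomputable def cylinder (j : ℕ) (y : Fin n → ZMod p) : (Fin n → ZMod p) → ZMod p :=
  open Classical in fun v => if Agree j v y then 1 else 0

lemma cylinder_dependsBelow (j : ℕ) (y : Fin n → ZMod p) : DependsBelow j (cylinder j y) := by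
  intro v w h
  have : Agree j v y ↔ Agree j w y := ⟨h.symm.trans, h.trans⟩
  simp only [cylinder]
  congr 1
  exact propext this

lemma cylinder_translate (j : ℕ) (y a : Fin n → ZMod p) :
    (fun v => cylinder j y (v - a)) = cylinder j (y + a) := by
  funext v
  have : Agree j (v - a) y ↔ Agree j v (y + a) := by
    refine forall₂_congr fun k _ => ?_
    simp [sub_eq_iff_eq_add]
  simp only [cylinder]
  congr 1
  exact propext this

/-- A function of the first `j` coordinates is a combination of indicator functions. -/
lemma eq_sum_cylinder [NeZero p] {j : ℕ} {f : (Fin n → ZMod p) → ZMod p}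
    (hf : DependsBelow j f) [DecidablePred fun y : Fin n → ZMod p => ∀ k : Fin n, j ≤ k → y k = 0] :
    f = ∑ y : Fin n → ZMod p with ∀ k : Fin n, j ≤ k → y k = 0,
      (f y).val • cylinder j y := by
  classical
  funext v
  rw [Finset.sum_apply, Finset.sum_eq_single (trunc j v)]
  · have h1 : Agree j v (trunc j v) := (agree_trunc j v).symm
    simp [cylinder, h1, hf _ _ h1]
  · intro y hy hne
    have : ¬ Agree j v y := fun h => hne <| by
      rw [trunc_congr h, trunc_eq_self (Finset.mem_filter.1 hy).2]
    simp [cylinder, this]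
  · intro h
    exact absurd (Finset.mem_filter.2 ⟨Finset.mem_univ _, fun k hk => trunc_apply_of_le v hk⟩) h

/-- To find all elementary permutations of a level in `S` it is enough to look at the indicator
functions. -/
lemma levelPerm_mem_of_cylinder [NeZero p] {S : Subgroup (Perm (Fin n → ZMod p))} {j : Fin n}
    (h : ∀ y, levelPerm j (cylinder j y) (cylinder_dependsBelow j y) ∈ S)
    (f : (Fin n → ZMod p) → ZMod p) (hf : DependsBelow j f) : levelPerm j f hf ∈ S := by
  classical
  have : f ∈ levelPreimage S j := by
    rw [eq_sum_cylinder hf]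
    exact sum_mem fun y _ => nsmul_mem (mem_levelPreimage.2 ⟨cylinder_dependsBelow j y, h y⟩) _
  exact this.2

/-- A triangular permutation in the `i`-th level is the product of its elementary factors. -/
lemma levelKer_le_of_levelPerm [NeZero p] {S : Subgroup (Perm (Fin n → ZMod p))} {i : ℕ}
    (h : ∀ j : Fin n, i ≤ j → ∀ f (hf : DependsBelow j f), levelPerm j f hf ∈ S) :
    levelKer p n i ≤ S := by
  suffices ∀ m i : ℕ, n ≤ i + m →
      (∀ j : Fin n, i ≤ j → ∀ f (hf : DependsBelow j f), levelPerm j f hf ∈ S) →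
      levelKer p n i ≤ S from this n i (by omega) h
  intro m
  induction m with
  | zero =>
    intro i hi _ g hg
    rw [eq_one_of_mem_levelKer hi hg]
    exact one_mem S
  | succ m ih =>
    intro i hi h g hg
    by_cases hin : n ≤ i
    · rw [eq_one_of_mem_levelKer hin hg]
      exact one_mem S
    obtain ⟨j, rfl⟩ : ∃ j : Fin n, (j : ℕ) = i := ⟨⟨i, by omega⟩, rfl⟩
    have h1 := h j le_rfl _ (hg.1 j)
    have h2 : g * (levelPerm j _ (hg.1 j))⁻¹ ∈ levelKer p n (j + 1) := by
      refine mem_levelKer_succ (mul_mem hg (inv_mem (levelPerm_mem_levelKer le_rfl _ _))) ?_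
      intro v
      obtain ⟨w, rfl⟩ := (levelPerm j _ (hg.1 j)).surjective v
      rw [Perm.mul_apply, Perm.inv_def, Equiv.symm_apply_apply, levelPerm_apply]
      simp
    have h4 := S.mul_mem (ih (j + 1) (by omega) (fun k hk => h k (by omega)) h2) h1
    simpa using h4

/-! ### Generation by the `σ_i` -/

lemma addRight_mul (a b : Fin n → ZMod p) :
    Equiv.addRight a * Equiv.addRight b = Equiv.addRight (a + b) := by
  ext1 v
  simp [add_assoc, add_comm a b]

lemma addRight_single_eq_levelPerm [NeZero p] (k : Fin n) (c : ZMod p) :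
    Equiv.addRight (Pi.single k c) = levelPerm k (fun _ => c) (DependsBelow.const _ c) := by
  ext1 v
  rw [levelPerm_apply, Equiv.coe_addRight]

lemma addRight_mem_of_levelPerm [NeZero p] {S : Subgroup (Perm (Fin n → ZMod p))}
    {a : Fin n → ZMod p}
    (h : ∀ k, a k ≠ 0 → ∀ f (hf : DependsBelow k f), levelPerm k f hf ∈ S) :
    Equiv.addRight a ∈ S := by
  have key : ∀ s : Finset (Fin n), Equiv.addRight (∑ k ∈ s, Pi.single k (a k)) ∈ S := by
    intro s
    induction s using Finset.induction_on with
    | empty => convert one_mem S; ext1 v; simp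
    | insert k s hk ih =>
      rw [Finset.sum_insert hk, ← addRight_mul]
      refine mul_mem ?_ ih
      by_cases hk0 : a k = 0
      · convert one_mem S; ext1 v; simp [hk0]
      · rw [addRight_single_eq_levelPerm]
        exact h k hk0 _ _
  simpa [Finset.univ_sum_single] using key Finset.univ

lemma sigmaPerm_eq_levelPerm [NeZero p] (i : Fin n) :
    sigmaPerm p n i = levelPerm i (cylinder i 0) (cylinder_dependsBelow _ _) := by
  ext1 v
  rw [levelPerm_apply]
  have h : (∀ j < i, v j = 0) ↔ Agree i v 0 := Iff.rfl
  by_cases hv : Agree i v 0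
  · simp only [sigmaPerm, Equiv.coe_fn_mk, if_pos (h.2 hv), cylinder, if_pos hv]
    funext k
    by_cases hk : k = i
    · subst hk; simp
    · simp [hk]
  · simp [sigmaPerm, Equiv.coe_fn_mk, if_neg (fun h' => hv (h.1 h')), cylinder, if_neg hv]

theorem sigmaGroup_eq_triGroup [NeZero p] : sigmaGroup p n = triGroup p n := by
  apply le_antisymm
  · rw [sigmaGroup, Subgroup.closure_le]
    rintro _ ⟨i, rfl⟩
    rw [sigmaPerm_eq_levelPerm]
    exact levelPerm_mem _ _ _
  · rw [← levelKer_zero]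
    apply levelKer_le_of_levelPerm
    intro j _
    obtain ⟨m, hm⟩ : ∃ m, m = (j : ℕ) := ⟨_, rfl⟩
    induction m using Nat.strong_induction_on generalizing j with
    | _ m ih =>
      refine levelPerm_mem_of_cylinder fun y => ?_
      -- a translation carries the cylinder at `0` to the cylinder at `y`
      have h1 : Equiv.addRight (trunc j y) ∈ sigmaGroup p n := by
        refine addRight_mem_of_levelPerm fun k hk => ih k ?_ k (Nat.zero_le _) rfl
        by_contra! hle
        exact hk (trunc_apply_of_le y (hm ▸ hle))
      have h2 : levelPerm j (cylinder j 0) (cylinder_dependsBelow _ _) ∈ sigmaGroup p n := by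
        rw [← sigmaPerm_eq_levelPerm]
        exact Subgroup.subset_closure ⟨j, rfl⟩
      have h3 := mul_mem (mul_mem h1 h2) (inv_mem h1)
      rw [addRight_conj_levelPerm] at h3
      convert h3 using 2
      rw [cylinder_translate, zero_add]
      funext v
      have : Agree j v y ↔ Agree j v (trunc j y) :=
        ⟨fun h => h.trans (agree_trunc _ _).symm, fun h => h.trans (agree_trunc _ _)⟩
      simp only [cylinder]
      congr 1
      exact propext this

/-! ### The diagonal group and the normalizer -/

/-- The action of the diagonal matrices on `𝔽_p ^ n`. -/
def diagHom (p n : ℕ) : (Fin n → (ZMod p)ˣ) →* Perm (Fin n → ZMod p) :=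
  MulAction.toPermHom _ _

@[simp] lemma diagHom_apply (c : Fin n → (ZMod p)ˣ) (v : Fin n → ZMod p) (k : Fin n) :
    diagHom p n c v k = c k * v k := rfl

lemma diagHom_injective : Function.Injective (diagHom p n) := by
  intro c d h
  funext k
  have := congrFun (congrArg (fun g : Perm (Fin n → ZMod p) => g 1) h) k
  simpa [Units.ext_iff] using this

lemma diagHom_inv_apply (c : Fin n → (ZMod p)ˣ) (v : Fin n → ZMod p) (k : Fin n) :
    (diagHom p n c)⁻¹ v k = ((c k)⁻¹ : (ZMod p)ˣ) * v k := by
  rw [← map_inv]; rfl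

lemma agree_diagHom {i : ℕ} {c : Fin n → (ZMod p)ˣ} {v w : Fin n → ZMod p}
    (h : Agree i v w) : Agree i (diagHom p n c v) (diagHom p n c w) :=
  fun k hk => by simp [h k hk]

lemma agree_diagHom_inv {i : ℕ} {c : Fin n → (ZMod p)ˣ} {v w : Fin n → ZMod p}
    (h : Agree i v w) : Agree i ((diagHom p n c)⁻¹ v) ((diagHom p n c)⁻¹ w) := by
  rw [← map_inv]; exact agree_diagHom h

lemma etaGroup_eq_range (r : (ZMod p)ˣ) (hr : Subgroup.zpowers r = ⊤) :
    etaGroup p n r = (diagHom p n).range := by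
  have heta : ∀ i, etaPerm p n r i = diagHom p n (Pi.mulSingle i r) := by
    intro i
    ext1 v
    funext k
    by_cases hk : k = i
    · subst hk; simp [etaPerm]
    · simp [etaPerm, hk]
  apply le_antisymm
  · rw [etaGroup, Subgroup.closure_le]
    rintro _ ⟨i, rfl⟩
    exact ⟨_, (heta i).symm⟩
  · rintro _ ⟨c, rfl⟩
    change c ∈ (etaGroup p n r).comap (diagHom p n)
    rw [← Finset.univ_prod_mulSingle c]
    refine Subgroup.prod_mem _ fun i _ => ?_
    obtain ⟨m, hm⟩ : c i ∈ Subgroup.zpowers r := hr ▸ Subgroup.mem_top _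
    simp only at hm
    rw [← hm, Pi.mulSingle_zpow]
    refine Subgroup.zpow_mem _ ?_ _
    rw [Subgroup.mem_comap, ← heta]
    exact Subgroup.subset_closure ⟨i, rfl⟩

lemma diag_conj_displacement (c : Fin n → (ZMod p)ˣ) (g : Perm (Fin n → ZMod p))
    (v : Fin n → ZMod p) (k : Fin n) :
    (diagHom p n c * g * (diagHom p n c)⁻¹) v k - v k =
      c k * (g ((diagHom p n c)⁻¹ v) k - ((diagHom p n c)⁻¹ v) k) := by
  rw [Perm.mul_apply, Perm.mul_apply, diagHom_apply, mul_sub, diagHom_inv_apply]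
  simp

lemma diag_conj_mem {c : Fin n → (ZMod p)ˣ} {g : Perm (Fin n → ZMod p)}
    (hg : g ∈ triGroup p n) : diagHom p n c * g * (diagHom p n c)⁻¹ ∈ triGroup p n := by
  intro k v w hvw
  simp only [diag_conj_displacement]
  exact congrArg (fun x => (c k : ZMod p) * x) (hg k _ _ (agree_diagHom_inv hvw))

/-- A triangular permutation that is central modulo the kernel of the action on the first `i + 1`
coordinates acts on these coordinates as a translation of the `i`-th. -/
lemma central_mod_levelKer [NeZero p] {i : Fin n} {w : Perm (Fin n → ZMod p)}
    (hw : w ∈ triGroup p n)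
    (h : ∀ g ∈ triGroup p n, ∀ v, Agree (i + 1) (w (g v)) (g (w v))) :
    w ∈ levelKer p n i ∧ ∀ v, w v i - v i = w 0 i - (0 : Fin n → ZMod p) i := by
  constructor
  · refine ⟨hw, fun v => ?_⟩
    -- compare the action on the `i`-th coordinate with the elementary permutation at `v`
    have h1 := h _ (levelPerm_mem i (cylinder i v) (cylinder_dependsBelow _ _)) v i (by simp)
    rw [levelPerm_apply, levelPerm_apply] at h1
    have h2 := hw i (v + Pi.single i (cylinder i v v)) v (agree_add_single v i _)
    have h3 : cylinder i v v = 1 := by simp [cylinder, Agree.refl]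
    simp only at h2
    rw [h1] at h2
    simp only [h3, Pi.add_apply, Pi.single_eq_same] at h2
    by_contra hne
    have h4 : cylinder i v (w v) = 0 := by simp [cylinder, hne]
    rw [h4] at h2
    by_cases h1p : p = 1
    · subst h1p
      exact hne fun k _ => Subsingleton.elim _ _
    · have : Fact (1 < p) := ⟨by have := NeZero.ne p; omega⟩
      have : (1 : ZMod p) = 0 := by linear_combination -h2
      exact one_ne_zero this
  · intro v
    have h1 := h _ (addRight_mem_triGroup v) 0 i (by simp)
    simp only [Equiv.coe_addRight, zero_add, Pi.add_apply] at h1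
    rw [h1]; simp

/-- An element of the normalizer preserves the relation of having the same first `i` coordinates,
and its `i`-th coordinate is affine in the `i`-th coordinate of the argument. -/
lemma affine_of_mem_normalizer [NeZero p] (i : ℕ) (hi : i ≤ n) :
    ∀ g ∈ Subgroup.normalizer (triGroup p n : Set (Perm (Fin n → ZMod p))),
      (∀ v w, Agree i v w → Agree i (g v) (g w)) ∧
      ∀ k : Fin n, i ≤ k → ∃ c : ZMod p, ∀ v w, Agree k v w →
        g v k - g w k = c * (v k - w k) := by
  induction hi using Nat.decreasingInduction with
  | self =>
    intro g _
    exact ⟨fun v w h => by rw [h.eq le_rfl]; exact Agree.refl _ _, fun k hk => by omega⟩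
  | of_succ i hi ih =>
    intro g hg
    obtain ⟨i, rfl⟩ : ∃ j : Fin n, (j : ℕ) = i := ⟨⟨i, hi⟩, rfl⟩
    obtain ⟨ih1, ih2⟩ := ih g hg
    set z : Perm (Fin n → ZMod p) := Equiv.addRight (Pi.single i 1) with hz
    have hzmem : z ∈ triGroup p n := addRight_mem_triGroup _
    have hg' := Subgroup.mem_normalizer_iff.1 hg
    have hw : g * z * g⁻¹ ∈ triGroup p n := (hg' z).1 hzmem
    have hcent : ∀ h ∈ triGroup p n, ∀ v,
        Agree (i + 1) ((g * z * g⁻¹) (h v)) (h ((g * z * g⁻¹) v)) := by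
      intro h hh v
      obtain ⟨u, rfl⟩ := g.surjective v
      have hh' : g⁻¹ * h * g ∈ triGroup p n := by
        rw [hg']; convert hh using 1; group
      have h1 : Agree (i + 1) (z ((g⁻¹ * h * g) u)) ((g⁻¹ * h * g) (z u)) := by
        have h2 : Agree i (z u) u := agree_add_single u i 1
        refine Agree.succ ?_ ?_
        · exact (agree_add_single _ i 1).trans ((agree_apply_iff hh').2 h2.symm)
        · have h3 := hh' i _ _ h2
          simp only [hz, Equiv.coe_addRight, Pi.add_apply, Pi.single_eq_same] at h3 ⊢
          linear_combination -h3
      have h4 := ih1 _ _ h1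
      simpa [Perm.mul_apply] using h4
    obtain ⟨hK, hconst⟩ := central_mod_levelKer hw hcent
    set c : ZMod p := (g * z * g⁻¹) 0 i - (0 : Fin n → ZMod p) i with hc
    have hstep : ∀ u, Agree i (g (u + Pi.single i 1)) (g u) ∧
        g (u + Pi.single i 1) i = g u i + c := by
      intro u
      have e : (g * z * g⁻¹) (g u) = g (u + Pi.single i 1) := by simp [Perm.mul_apply, hz]
      have h1 := hK.2 (g u)
      have h2 := hconst (g u)
      rw [e] at h1 h2
      exact ⟨h1, by linear_combination h2⟩
    have hiter : ∀ (m : ℕ) u, Agree i (g (u + Pi.single i (m : ZMod p))) (g u) ∧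
        g (u + Pi.single i (m : ZMod p)) i = g u i + m * c := by
      intro m
      induction m with
      | zero => intro u; simp [Agree.refl]
      | succ m ihm =>
        intro u
        have h1 := ihm u
        have h2 := hstep (u + Pi.single i (m : ZMod p))
        rw [add_assoc, ← Pi.single_add, ← Nat.cast_succ] at h2
        refine ⟨h2.1.trans h1.1, ?_⟩
        rw [h2.2, h1.2]; push_cast; ring
    have hmain : ∀ v w, Agree i v w → Agree i (g v) (g w) ∧ g v i - g w i = c * (v i - w i) := by
      intro v w hvw
      have h1 := hiter (v i - w i).val w
      rw [ZMod.natCast_zmod_val] at h1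
      have h2 : Agree (i + 1) v (w + Pi.single i (v i - w i)) :=
        Agree.succ (hvw.trans (agree_add_single _ _ _).symm) (by simp)
      have h3 := ih1 _ _ h2
      refine ⟨(h3.mono (Nat.le_succ _)).trans h1.1, ?_⟩
      rw [h3 i (by simp), h1.2]; ring
    refine ⟨fun v w h => (hmain v w h).1, fun k hk => ?_⟩
    rcases hk.lt_or_eq with hk | hk
    · exact ih2 k hk
    · obtain rfl : i = k := Fin.ext hk
      exact ⟨c, fun v w h => (hmain v w h).2⟩

/-- Dividing an element of the normalizer by the linear parts of its coordinates leaves a triangular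
permutation. -/
lemma exists_diagHom_mul [Fact p.Prime] {g : Perm (Fin n → ZMod p)}
    (hg : g ∈ Subgroup.normalizer (triGroup p n : Set (Perm (Fin n → ZMod p)))) :
    ∃ c, ∃ q ∈ triGroup p n, diagHom p n c * q = g := by
  choose c hc using fun k : Fin n => (affine_of_mem_normalizer 0 (Nat.zero_le n) g hg).2 k
    (Nat.zero_le _)
  have hc0 : ∀ k, c k ≠ 0 := by
    intro k h0
    have h1 := hc k (Pi.single k 1) 0 (by simpa using agree_add_single 0 k (1 : ZMod p))
    have h2 := (affine_of_mem_normalizer k k.2.le g hg).1 _ _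
      (by simpa using agree_add_single 0 k (1 : ZMod p) : Agree k (Pi.single k 1) 0)
    have h3 : Agree (k + 1) (g (Pi.single k 1)) (g 0) :=
      h2.succ (by rw [h0, zero_mul] at h1; exact sub_eq_zero.1 h1)
    have h4 := (affine_of_mem_normalizer (k + 1) k.2 g⁻¹ (inv_mem hg)).1 _ _ h3 k (by simp)
    simp at h4
  refine ⟨fun k => Units.mk0 (c k) (hc0 k), (diagHom p n fun k => Units.mk0 (c k) (hc0 k))⁻¹ * g,
    ?_, by simp⟩
  intro k v w hvw
  have h1 := hc k v w hvw
  simp only [Perm.mul_apply, diagHom_inv_apply]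
  have h2 : (((Units.mk0 (c k) (hc0 k))⁻¹ : (ZMod p)ˣ) : ZMod p) * c k = 1 := by
    simpa using inv_mul_cancel₀ (hc0 k)
  linear_combination (((Units.mk0 (c k) (hc0 k))⁻¹ : (ZMod p)ˣ) : ZMod p) * h1 +
    (v k - w k) * h2

lemma diagHom_mem_normalizer (c : Fin n → (ZMod p)ˣ) :
    diagHom p n c ∈ Subgroup.normalizer (triGroup p n : Set (Perm (Fin n → ZMod p))) := by
  rw [Subgroup.mem_normalizer_iff]
  refine fun g => ⟨diag_conj_mem, fun h => ?_⟩
  have := diag_conj_mem (c := c⁻¹) h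
  rw [map_inv] at this
  convert this using 1
  group

lemma range_diagHom_inf_triGroup : (diagHom p n).range ⊓ triGroup p n = ⊥ := by
  rw [eq_bot_iff]
  rintro _ ⟨⟨c, rfl⟩, h⟩
  rw [Subgroup.mem_bot, ← map_one (diagHom p n)]
  congr 1
  funext k
  have h1 := h k (Pi.single k 1) 0 (by simpa using agree_add_single 0 k (1 : ZMod p))
  simp only [diagHom_apply] at h1
  ext
  simpa [sub_eq_zero] using h1

lemma isPGroup_triGroup [Fact p.Prime] : IsPGroup p (triGroup p n) := by
  have key : ∀ i : ℕ, i ≤ n → ∀ g ∈ triGroup p n, g ^ p ^ i ∈ levelKer p n i := by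
    intro i
    induction i with
    | zero => intro _ g hg; rw [levelKer_zero]; simpa using hg
    | succ i ih =>
      intro hi g hg
      have h1 := ih (by omega) g hg
      set k := g ^ p ^ i
      obtain ⟨i, rfl⟩ : ∃ j : Fin n, (j : ℕ) = i := ⟨⟨i, hi⟩, rfl⟩
      rw [pow_succ, pow_mul]
      exact mem_levelKer_succ (pow_mem h1 p) fun v => by rw [pow_apply_level h1]; simp
  intro g
  exact ⟨n, Subtype.ext <| eq_one_of_mem_levelKer le_rfl (key n le_rfl g g.2)⟩

lemma isComplement_diag_tri [Fact p.Prime] :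
    ((diagHom p n).range.subgroupOf
      (Subgroup.normalizer (triGroup p n : Set (Perm (Fin n → ZMod p))))).IsComplement'
    ((triGroup p n).subgroupOf
      (Subgroup.normalizer (triGroup p n : Set (Perm (Fin n → ZMod p))))) := by
  apply Subgroup.isComplement'_of_disjoint_and_mul_eq_univ
  · rw [disjoint_iff, eq_bot_iff]
    rintro ⟨g, hg⟩ ⟨h1, h2⟩
    have : g ∈ (diagHom p n).range ⊓ triGroup p n := ⟨h1, h2⟩
    rw [range_diagHom_inf_triGroup, Subgroup.mem_bot] at this
    exact Subtype.ext this
  · rw [Set.eq_univ_iff_forall]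
    rintro ⟨g, hg⟩
    obtain ⟨c, q, hq, rfl⟩ := exists_diagHom_mul hg
    exact ⟨⟨_, diagHom_mem_normalizer c⟩, ⟨c, rfl⟩, ⟨q, Subgroup.le_normalizer hq⟩, hq, rfl⟩

lemma coprime_card_range_diagHom [Fact p.Prime] : (Nat.card (diagHom p n).range).Coprime p := by
  rw [← Nat.card_congr (MonoidHom.ofInjective (diagHom_injective (p := p) (n := n))).toEquiv,
    Nat.card_pi, Finset.prod_const]
  apply Nat.Coprime.pow_left
  rw [Nat.card_eq_fintype_card, ZMod.card_units]
  have := (Fact.out : p.Prime).two_le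
  exact (Nat.coprime_of_lt_prime (by omega) (by omega) Fact.out).symm

theorem isHallPrimeToIn_range_diagHom [Fact p.Prime] :
    IsHallPrimeToIn p (diagHom p n).range
      (Subgroup.normalizer (triGroup p n : Set (Perm (Fin n → ZMod p)))) := by
  have hle : (diagHom p n).range ≤
      Subgroup.normalizer (triGroup p n : Set (Perm (Fin n → ZMod p))) := by
    rintro _ ⟨c, rfl⟩
    exact diagHom_mem_normalizer c
  refine ⟨hle, ?_, ?_⟩
  · rw [Nat.card_congr (Subgroup.subgroupOfEquivOfLe hle).toEquiv]
    exact coprime_card_range_diagHom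
  · rw [isComplement_diag_tri.symm.index_eq_card,
      Nat.card_congr (Subgroup.subgroupOfEquivOfLe Subgroup.le_normalizer).toEquiv]
    exact IsPGroup.iff_card.1 isPGroup_triGroup

/-- The index of a `p`-subgroup in its normalizer is congruent modulo `p` to its index in the whole
group, so it is not necessary to count the triangular permutations. -/
theorem exists_sylow_eq_triGroup [Fact p.Prime] :
    ∃ P : Sylow p (Perm (Fin n → ZMod p)), (P : Subgroup _) = triGroup p n := by
  obtain ⟨m, hm⟩ := IsPGroup.iff_card.1 (isPGroup_triGroup (p := p) (n := n))
  have h1 := Sylow.card_quotient_normalizer_modEq_card_quotient hm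
  refine ⟨IsPGroup.toSylow isPGroup_triGroup ?_, rfl⟩
  intro hdvd
  rw [Subgroup.index, ← Nat.modEq_zero_iff_dvd] at hdvd
  have h2 := (h1.trans hdvd)
  rw [Nat.modEq_zero_iff_dvd] at h2
  have h3 : p ∣ ((triGroup p n).subgroupOf
      (Subgroup.normalizer (triGroup p n : Set (Perm (Fin n → ZMod p))))).index := h2
  rw [isComplement_diag_tri.index_eq_card] at h3
  have h4 := isHallPrimeToIn_range_diagHom (p := p) (n := n)
  exact (Fact.out : p.Prime).coprime_iff_not_dvd.1 h4.2.1.symm h3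

theorem nonempty_mulEquiv_range_diagHom [Fact p.Prime] :
    Nonempty ((diagHom p n).range ≃* (Fin n → Multiplicative (ZMod (p - 1)))) := by
  have h : Nat.card (ZMod p)ˣ = p - 1 := by rw [Nat.card_eq_fintype_card, ZMod.card_units]
  have e : (ZMod p)ˣ ≃* Multiplicative (ZMod (p - 1)) :=
    (h ▸ zmodCyclicMulEquiv (G := (ZMod p)ˣ) inferInstance).symm
  exact ⟨(MonoidHom.ofInjective diagHom_injective).symm.trans (MulEquiv.piCongrRight fun _ => e)⟩

/-! ### The abelianization of the kernels of the level actions -/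

section FiberSum

variable [NeZero p]

/-- The vectors that agree with `x` below `i` and vanish from the `j`-th coordinate on. They
represent the prefixes of length `j` that extend the prefix of `x` of length `i`. -/
noncomputable def fiber (i j : ℕ) (x : Fin n → ZMod p) : Finset (Fin n → ZMod p) :=
  open Classical in {v | Agree i v x ∧ ∀ k : Fin n, j ≤ k → v k = 0}

lemma mem_fiber {i j : ℕ} {x v : Fin n → ZMod p} :
    v ∈ fiber i j x ↔ Agree i v x ∧ ∀ k : Fin n, j ≤ k → v k = 0 := by
  simp [fiber]

lemma fiber_congr {i : ℕ} (j : ℕ) {x y : Fin n → ZMod p} (h : Agree i x y) :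
    fiber i j x = fiber i j y := by
  ext v
  rw [mem_fiber, mem_fiber]
  exact and_congr_left fun _ => ⟨fun h' => h'.trans h, fun h' => h'.trans h.symm⟩

lemma trunc_mem_fiber {i j : ℕ} (hij : i ≤ j) {v x : Fin n → ZMod p} (h : Agree i v x) :
    trunc j v ∈ fiber i j x :=
  mem_fiber.2 ⟨((agree_trunc j v).mono hij).trans h, fun _ hk => trunc_apply_of_le v hk⟩

/-- Triangular permutations permute the fibres of the projections between prefixes. -/
lemma sum_fiber_apply {i j : ℕ} (hij : i ≤ j) {h : Perm (Fin n → ZMod p)}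
    (hh : h ∈ triGroup p n) {f : (Fin n → ZMod p) → ZMod p} (hf : DependsBelow j f)
    (x : Fin n → ZMod p) : ∑ v ∈ fiber i j (h x), f v = ∑ v ∈ fiber i j x, f (h v) := by
  symm
  refine Finset.sum_nbij' (fun v => trunc j (h v)) (fun v => trunc j (h⁻¹ v)) ?_ ?_ ?_ ?_ ?_
  · intro v hv
    exact trunc_mem_fiber hij ((agree_apply_iff hh).2 (mem_fiber.1 hv).1)
  · intro v hv
    refine trunc_mem_fiber hij ?_
    rw [← agree_apply_iff hh]
    simpa using (mem_fiber.1 hv).1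
  · intro v hv
    have h1 : Agree j (h⁻¹ (trunc j (h v))) v := by
      rw [← agree_apply_iff hh]; simpa using agree_trunc j (h v)
    rw [trunc_congr h1, trunc_eq_self (mem_fiber.1 hv).2]
  · intro v hv
    have h1 : Agree j (h (trunc j (h⁻¹ v))) v := by
      have := (agree_apply_iff hh).2 (agree_trunc j (h⁻¹ v))
      simpa using this
    rw [trunc_congr h1, trunc_eq_self (mem_fiber.1 hv).2]
  · intro v _
    exact hf _ _ (agree_trunc j (h v)).symm

/-- For a triangular permutation `g` that fixes the first `i` coordinates and `j ≥ i`, the sum of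
the displacements of the `j`-th coordinate over the prefixes that extend the prefix of `x` of
length `i`. As a function of `g`, the family of these sums is the abelianization map of
`levelKer p n i`. -/
noncomputable def psi (i : ℕ) (g : Perm (Fin n → ZMod p)) (j : Fin n) (x : Fin n → ZMod p) :
    ZMod p :=
  ∑ v ∈ fiber i j x, (g v j - v j)

lemma psi_congr {i : ℕ} (g : Perm (Fin n → ZMod p)) (j : Fin n) {x y : Fin n → ZMod p}
    (h : Agree i x y) : psi i g j x = psi i g j y := by
  rw [psi, fiber_congr _ h, psi]

lemma psi_mul {i : ℕ} {a b : Perm (Fin n → ZMod p)} (ha : a ∈ triGroup p n)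
    (hb : b ∈ levelKer p n i) {j : Fin n} (hij : i ≤ j) (x : Fin n → ZMod p) :
    psi i (a * b) j x = psi i a j x + psi i b j x := by
  have h1 : psi i a j x = ∑ v ∈ fiber i j x, (a (b v) j - b v j) := by
    rw [← psi_congr a j (hb.2 x), psi, sum_fiber_apply hij hb.1 (ha j)]
  rw [h1, psi, psi, ← Finset.sum_add_distrib]
  refine Finset.sum_congr rfl fun v _ => ?_
  rw [Perm.mul_apply]; ring

lemma psi_one (i : ℕ) (j : Fin n) (x : Fin n → ZMod p) : psi i 1 j x = 0 := by simp [psi]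

lemma psi_mul_inv {i : ℕ} {a b : Perm (Fin n → ZMod p)} (ha : a ∈ levelKer p n i)
    (hb : b ∈ levelKer p n i) {j : Fin n} (hij : i ≤ j) (x : Fin n → ZMod p) :
    psi i (a * b⁻¹) j x = psi i a j x - psi i b j x := by
  rw [eq_sub_iff_add_eq, ← psi_mul (mul_mem ha (inv_mem hb)).1 hb hij, inv_mul_cancel_right]

lemma psi_conj {i : ℕ} {g k : Perm (Fin n → ZMod p)} (hg : g ∈ triGroup p n)
    (hk : k ∈ levelKer p n i) {j : Fin n} (hij : i ≤ j) (x : Fin n → ZMod p) :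
    psi i (g * k * g⁻¹) j (g x) = psi i k j x := by
  have h1 : ∑ v ∈ fiber i j x, (g (k v) j - k v j) = ∑ v ∈ fiber i j x, (g v j - v j) := by
    rw [← sum_fiber_apply hij hk.1 (hg j), fiber_congr _ (hk.2 x)]
  rw [psi, sum_fiber_apply hij hg ((conj_mem_levelKer hg hk).1 j), psi]
  have h2 : ∀ v, (g * k * g⁻¹) (g v) j - g v j =
      (g (k v) j - k v j) + (k v j - v j) - (g v j - v j) := by
    intro v
    simp [Perm.mul_apply]
  rw [Finset.sum_congr rfl fun v _ => h2 v, Finset.sum_sub_distrib, Finset.sum_add_distrib, h1]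
  ring

lemma psi_conj_of_mem {i : ℕ} {g k : Perm (Fin n → ZMod p)} (hg : g ∈ levelKer p n i)
    (hk : k ∈ levelKer p n i) {j : Fin n} (hij : i ≤ j) (x : Fin n → ZMod p) :
    psi i (g * k * g⁻¹) j x = psi i k j x := by
  rw [← psi_congr _ j (hg.2 x), psi_conj hg.1 hk hij]

lemma psi_eq_zero_of_mem_commutator {i : ℕ} {g : Perm (Fin n → ZMod p)}
    (hg : g ∈ ⁅levelKer p n i, levelKer p n i⁆) {j : Fin n} (hij : i ≤ j) (x : Fin n → ZMod p) :
    psi i g j x = 0 := by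
  have h1 : ⁅levelKer p n i, levelKer p n i⁆ ≤ levelKer p n i :=
    Subgroup.commutator_le.2 fun a ha b hb => by
      rw [commutatorElement_def]
      exact mul_mem (mul_mem (mul_mem ha hb) (inv_mem ha)) (inv_mem hb)
  have h2 : ⁅levelKer p n i, levelKer p n i⁆ ≤
      { carrier := {g | g ∈ levelKer p n i ∧ psi i g j x = 0}
        one_mem' := ⟨one_mem _, psi_one i j x⟩
        mul_mem' := fun {a b} ha hb =>
          ⟨mul_mem ha.1 hb.1, by rw [psi_mul ha.1.1 hb.1 hij, ha.2, hb.2, add_zero]⟩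
        inv_mem' := fun {a} ha => ⟨inv_mem ha.1, by
          rw [← one_mul a⁻¹, psi_mul_inv (one_mem _) ha.1 hij, psi_one, ha.2, sub_zero]⟩ :
        Subgroup (Perm (Fin n → ZMod p)) } := by
    refine Subgroup.commutator_le.2 fun a ha b hb => ?_
    have hc := conj_mem_levelKer ha.1 hb
    rw [commutatorElement_def]
    exact ⟨mul_mem hc (inv_mem hb), by
      rw [psi_mul_inv hc hb hij, psi_conj_of_mem ha hb hij, sub_self]⟩
  exact (h2 hg).2

lemma levelPerm_mul_inv (j : Fin n) {f g : (Fin n → ZMod p) → ZMod p}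
    (hf : DependsBelow j f) (hg : DependsBelow j g) (hfg : DependsBelow j (f - g)) :
    levelPerm j f hf * (levelPerm j g hg)⁻¹ = levelPerm j (f - g) hfg := by
  rw [mul_inv_eq_iff_eq_mul, levelPerm_mul]
  congr 1
  exact (sub_add_cancel f g).symm

/-- The difference of two indicator functions with the same prefix of length `i` comes from a
commutator with a translation. -/
lemma levelPerm_mem_commutator {i : ℕ} {j : Fin n} (hij : i ≤ j)
    {f : (Fin n → ZMod p) → ZMod p} (hf : DependsBelow j f)
    (hsum : ∀ x, ∑ v ∈ fiber i j x, f v = 0) :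
    levelPerm j f hf ∈ ⁅levelKer p n i, levelKer p n i⁆ := by
  classical
  have h1 : ∑ y : Fin n → ZMod p with ∀ k : Fin n, (j : ℕ) ≤ k → y k = 0,
      (f y).val • cylinder j (trunc i y) = 0 := by
    funext v
    rw [Finset.sum_apply]
    have h2 : ∀ y : Fin n → ZMod p, ((f y).val • cylinder j (trunc i y)) v =
        if Agree j v (trunc i y) then f y else 0 := by
      intro y
      by_cases hy : Agree j v (trunc i y) <;> simp [cylinder, hy]
    rw [Finset.sum_congr rfl fun y _ => h2 y, ← Finset.sum_filter, Finset.filter_filter]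
    by_cases hex : ∃ y, Agree j v (trunc i y)
    · obtain ⟨y, hy⟩ := hex
      refine Eq.trans ?_ (hsum y)
      refine Finset.sum_congr ?_ fun _ _ => rfl
      ext u
      rw [mem_fiber, Finset.mem_filter]
      simp only [Finset.mem_univ, true_and]
      constructor
      · rintro ⟨h3, h4⟩
        refine ⟨?_, h3⟩
        exact (agree_trunc i u).symm.trans (((h4.symm.trans hy).mono hij).trans (agree_trunc i y))
      · rintro ⟨h3, h4⟩
        refine ⟨h4, ?_⟩
        rwa [trunc_congr h3]
    · rw [Finset.filter_false_of_mem, Finset.sum_empty]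
      · rfl
      · rintro u _ ⟨_, h⟩
        exact hex ⟨u, h⟩
  have h2 : f = ∑ y : Fin n → ZMod p with ∀ k : Fin n, (j : ℕ) ≤ k → y k = 0,
      (f y).val • (cylinder j y - cylinder j (trunc i y)) := by
    conv_lhs => rw [eq_sum_cylinder hf, ← sub_zero (Finset.sum _ _), ← h1]
    rw [← Finset.sum_sub_distrib]
    exact Finset.sum_congr rfl fun y _ => (smul_sub _ _ _).symm
  have h3 : f ∈ levelPreimage ⁅levelKer p n i, levelKer p n i⁆ j := by
    rw [h2]
    refine sum_mem fun y _ => nsmul_mem ?_ _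
    have h4 : DependsBelow j (cylinder j y - cylinder j (trunc i y)) := by
      rw [sub_eq_add_neg]
      exact (cylinder_dependsBelow _ _).add (cylinder_dependsBelow _ _).neg
    refine mem_levelPreimage.2 ⟨h4, ?_⟩
    rw [← levelPerm_mul_inv j (cylinder_dependsBelow _ _) (cylinder_dependsBelow _ _)]
    have h5 := addRight_conj_levelPerm (y - trunc i y) j (cylinder j (trunc i y))
      (cylinder_dependsBelow _ _)
    have h6 : levelPerm j (cylinder j y) (cylinder_dependsBelow _ _) =
        Equiv.addRight (y - trunc i y) * levelPerm j (cylinder j (trunc i y))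
          (cylinder_dependsBelow _ _) * (Equiv.addRight (y - trunc i y))⁻¹ := by
      rw [h5]
      congr 1
      rw [cylinder_translate, add_sub_cancel]
    rw [h6, ← commutatorElement_def]
    refine Subgroup.commutator_mem_commutator (addRight_mem_levelKer fun k hk => ?_)
      (levelPerm_mem_levelKer hij _ _)
    simp [trunc, hk]
  exact h3.2

/-- The kernel of the abelianization map `psi i` is the commutator subgroup. -/
lemma mem_commutator_of_psi_eq_zero {i : ℕ} {g : Perm (Fin n → ZMod p)}
    (hg : g ∈ levelKer p n i) (h : ∀ j : Fin n, i ≤ j → ∀ x, psi i g j x = 0) :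
    g ∈ ⁅levelKer p n i, levelKer p n i⁆ := by
  suffices ∀ m l : ℕ, n ≤ l + m → i ≤ l → ∀ g ∈ levelKer p n l,
      (∀ j : Fin n, i ≤ j → ∀ x, psi i g j x = 0) → g ∈ ⁅levelKer p n i, levelKer p n i⁆ from
    this n i (by omega) le_rfl g hg h
  intro m
  induction m with
  | zero =>
    intro l hl _ g hg _
    rw [eq_one_of_mem_levelKer hl hg]
    exact one_mem _
  | succ m ih =>
    intro l hl hil g hg h
    by_cases hnl : n ≤ l
    · rw [eq_one_of_mem_levelKer hnl hg]
      exact one_mem _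
    obtain ⟨j, rfl⟩ : ∃ j : Fin n, (j : ℕ) = l := ⟨⟨l, by omega⟩, rfl⟩
    -- split off the factor of `g` at the `j`-th level
    have h1 : levelPerm j _ (hg.1 j) ∈ ⁅levelKer p n i, levelKer p n i⁆ :=
      levelPerm_mem_commutator hil (hg.1 j) fun x => h j hil x
    have h2 : g * (levelPerm j _ (hg.1 j))⁻¹ ∈ levelKer p n (j + 1) := by
      refine mem_levelKer_succ (mul_mem hg (inv_mem (levelPerm_mem_levelKer le_rfl _ _))) ?_
      intro v
      obtain ⟨w, rfl⟩ := (levelPerm j _ (hg.1 j)).surjective v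
      rw [Perm.mul_apply, Perm.inv_def, Equiv.symm_apply_apply, levelPerm_apply]
      simp
    have h3 := ih (j + 1) (by omega) (by omega) _ h2 fun k hk x => by
      rw [psi_mul_inv (levelKer_anti hil hg) (levelPerm_mem_levelKer hil _ _) hk, h k hk,
        psi_eq_zero_of_mem_commutator h1 hk, sub_zero]
    simpa using mul_mem h3 h1

end FiberSum

/-! ### Normal subgroups contain commutator subgroups of level kernels -/

section Normal

variable [NeZero p] {N : Subgroup (Perm (Fin n → ZMod p))}

lemma commutator_levelKer_le_of_cylinder {i : ℕ}
    (hN : ∀ g ∈ triGroup p n, ∀ k ∈ N, g * k * g⁻¹ ∈ N)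
    (h : ∀ j l : Fin n, i ≤ j → i ≤ l → ∀ y z : Fin n → ZMod p,
      ⁅levelPerm j (cylinder j y) (cylinder_dependsBelow _ _),
        levelPerm l (cylinder l z) (cylinder_dependsBelow _ _)⁆ ∈ N) :
    ⁅levelKer p n i, levelKer p n i⁆ ≤ N := by
  -- the elements of the triangular group that commute with `a` modulo `N`
  have key : ∀ a ∈ triGroup p n, (∀ l : Fin n, i ≤ l → ∀ z : Fin n → ZMod p,
      ⁅a, levelPerm l (cylinder l z) (cylinder_dependsBelow _ _)⁆ ∈ N) →
      ∀ b ∈ levelKer p n i, ⁅a, b⁆ ∈ N := by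
    intro a ha hgen
    let Z : Subgroup (Perm (Fin n → ZMod p)) :=
      { carrier := {b | b ∈ triGroup p n ∧ ⁅a, b⁆ ∈ N}
        one_mem' := ⟨one_mem _, by simp⟩
        mul_mem' := by
          rintro b c ⟨hb, hb'⟩ ⟨hc, hc'⟩
          refine ⟨mul_mem hb hc, ?_⟩
          have : ⁅a, b * c⁆ = ⁅a, b⁆ * (b * ⁅a, c⁆ * b⁻¹) := by
            simp only [commutatorElement_def]; group
          rw [this]
          exact mul_mem hb' (hN b hb _ hc')
        inv_mem' := by
          rintro b ⟨hb, hb'⟩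
          refine ⟨inv_mem hb, ?_⟩
          have : ⁅a, b⁻¹⁆ = b⁻¹ * ⁅a, b⁆⁻¹ * b⁻¹⁻¹ := by
            simp only [commutatorElement_def]; group
          rw [this]
          exact hN _ (inv_mem hb) _ (inv_mem hb') }
    have hZ : levelKer p n i ≤ Z := levelKer_le_of_levelPerm fun l hl =>
      levelPerm_mem_of_cylinder fun z => ⟨levelPerm_mem _ _ _, hgen l hl z⟩
    exact fun b hb => (hZ hb).2
  refine Subgroup.commutator_le.2 fun a ha b hb => ?_
  refine key a ha.1 (fun l hl z => ?_) b hb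
  rw [← inv_mem_iff, commutatorElement_inv]
  refine key _ (levelPerm_mem _ _ _) (fun j hj y => ?_) a ha
  exact h l j hl hj z y

lemma levelPerm_cylinder_apply_of_not_agree {j : Fin n} {m : ℕ} (hm : m ≤ j)
    {y v : Fin n → ZMod p} (h : ¬ Agree m v y) :
    levelPerm j (cylinder j y) (cylinder_dependsBelow _ _) v = v := by
  have : ¬ Agree j v y := fun h' => h (h'.mono hm)
  rw [levelPerm_apply]
  simp [cylinder, this]

/-- If the normal subgroup `N` contains an element that fixes the coordinates before the `i`-th and
adds `1` to the `i`-th one, then it contains the commutator subgroup of `levelKer p n i`: modulo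
`N`, an element supported on one cylinder of length `i + 1` is congruent to an element supported on
another one, and so commutes with all elements supported on the first. -/
lemma commutator_levelKer_le (hp : p ≠ 1) {i : Fin n}
    (hN : ∀ g ∈ triGroup p n, ∀ k ∈ N, g * k * g⁻¹ ∈ N) {g : Perm (Fin n → ZMod p)}
    (hgN : g ∈ N) (hg : g ∈ levelKer p n i) (hg1 : ∀ v, g v i = v i + 1) :
    ⁅levelKer p n i, levelKer p n i⁆ ≤ N := by
  have : Fact (1 < p) := ⟨by have := NeZero.ne p; omega⟩
  have hconj : ∀ b ∈ triGroup p n, g * b * g⁻¹ * b⁻¹ ∈ N := by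
    intro b hb
    have h := mul_mem hgN (hN b hb _ (inv_mem hgN))
    convert h using 1
    group
  have hstep : ⁅levelKer p n (i + 1), levelKer p n (i + 1)⁆ ≤ N := by
    refine commutator_levelKer_le_of_cylinder hN fun j l hj hl y z => ?_
    set a := levelPerm j (cylinder j y) (cylinder_dependsBelow _ _) with ha
    set b := levelPerm l (cylinder l z) (cylinder_dependsBelow _ _) with hb
    by_cases hyz : Agree (i + 1) y z
    · have hdisj : a.Disjoint (g * b * g⁻¹) := by
        intro v
        by_cases hv : Agree (i + 1) v y
        · right
          have h1 : ¬ Agree (i + 1) (g⁻¹ v) z := by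
            intro h2
            have h3 := h2 i (by simp)
            have h4 := (hv.trans hyz) i (by simp)
            have h5 := hg1 (g⁻¹ v)
            have h6 : g (g⁻¹ v) = v := g.apply_symm_apply v
            rw [h6, h3, h4, left_eq_add] at h5
            exact one_ne_zero h5
          rw [Perm.mul_apply, Perm.mul_apply, levelPerm_cylinder_apply_of_not_agree hl h1]
          simp
        · exact Or.inl (levelPerm_cylinder_apply_of_not_agree hj hv)
      have hcomm : a * (g * b * g⁻¹) = g * b * g⁻¹ * a := hdisj.commute
      have hbN := hconj b (levelPerm_mem _ _ _)
      -- `⁅a, b⁆` is congruent to `⁅a, g b g⁻¹⁆ = 1`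
      have h1 := mul_mem (hN a (levelPerm_mem _ _ _) _ (inv_mem hbN)) hbN
      convert h1 using 1
      rw [commutatorElement_def]
      have : a * (g * b * g⁻¹ * b⁻¹)⁻¹ * a⁻¹ * (g * b * g⁻¹ * b⁻¹) =
          a * b * ((g * b * g⁻¹)⁻¹ * a⁻¹ * (g * b * g⁻¹)) * b⁻¹ := by group
      rw [this]
      have h2 : (g * b * g⁻¹)⁻¹ * a⁻¹ * (g * b * g⁻¹) = a⁻¹ := by
        rw [mul_assoc, inv_mul_eq_iff_eq_mul, inv_mul_eq_iff_eq_mul, ← mul_assoc, hcomm,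
          mul_inv_cancel_right]
      rw [h2]
    · have hdisj : a.Disjoint b := by
        intro v
        by_cases hv : Agree (i + 1) v y
        · exact Or.inr <| levelPerm_cylinder_apply_of_not_agree hl fun h => hyz (hv.symm.trans h)
        · exact Or.inl (levelPerm_cylinder_apply_of_not_agree hj hv)
      rw [commutatorElement_eq_one_iff_commute.2 hdisj.commute]
      exact one_mem N
  have hmixed : ∀ l : Fin n, (i : ℕ) + 1 ≤ l → ∀ y z : Fin n → ZMod p,
      ⁅levelPerm i (cylinder i y) (cylinder_dependsBelow _ _),
        levelPerm l (cylinder l z) (cylinder_dependsBelow _ _)⁆ ∈ N := by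
    intro l hl y z
    set a := levelPerm i (cylinder i y) (cylinder_dependsBelow _ _) with ha
    set b := levelPerm l (cylinder l z) (cylinder_dependsBelow _ _) with hb
    have ham : a ∈ levelKer p n i := levelPerm_mem_levelKer le_rfl _ _
    have hbm : b ∈ levelKer p n (i + 1) := levelPerm_mem_levelKer hl _ _
    by_cases hyz : Agree i y z
    · have hbz : ∀ (j : Fin n) u, ¬ Agree i u z → psi (i + 1) b j u = 0 := by
        intro j u hu
        refine Finset.sum_eq_zero fun v hv => ?_
        rw [hb, levelPerm_cylinder_apply_of_not_agree (m := i) (by omega), sub_self]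
        intro h
        exact hu ((((mem_fiber.1 hv).1.mono (Nat.le_succ _)).symm).trans h)
      -- `a` and `g` act in the same way on the cylinder of `y`
      have hpsi : ∀ j : Fin n, (i : ℕ) + 1 ≤ j → ∀ x,
          psi (i + 1) (a * b * a⁻¹) j x = psi (i + 1) (g * b * g⁻¹) j x := by
        intro j hj x
        have e1 := psi_conj ham.1 hbm hj (a⁻¹ x)
        have e2 := psi_conj hg.1 hbm hj (g⁻¹ x)
        have ea : a (a⁻¹ x) = x := a.apply_symm_apply x
        have eg : g (g⁻¹ x) = x := g.apply_symm_apply x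
        rw [ea] at e1
        rw [eg] at e2
        rw [e1, e2]
        have ka : Agree i (a⁻¹ x) x := (inv_mem ham).2 x
        have kg : Agree i (g⁻¹ x) x := (inv_mem hg).2 x
        by_cases hx : Agree i x y
        · refine psi_congr _ _ ((ka.trans kg.symm).succ ?_)
          have h1 := hg1 (g⁻¹ x)
          rw [eg] at h1
          have h2 : x i = (a⁻¹ x) i + 1 := by
            conv_lhs => rw [← ea]
            rw [ha, levelPerm_apply]
            have : Agree i (a⁻¹ x) y := ka.trans hx
            rw [← ha]
            simp only [cylinder, if_pos this, Pi.add_apply, Pi.single_eq_same]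
          exact add_right_cancel (h2.symm.trans h1)
        · have hx' : ¬ Agree i x z := fun h => hx (h.trans hyz.symm)
          rw [hbz _ _ fun h => hx' (ka.symm.trans h), hbz _ _ fun h => hx' (kg.symm.trans h)]
      have hA := conj_mem_levelKer ham.1 hbm
      have hG := conj_mem_levelKer hg.1 hbm
      have h1 := hstep (mem_commutator_of_psi_eq_zero (mul_mem hA (inv_mem hG)) fun j hj x => by
        rw [psi_mul_inv hA hG hj, hpsi j hj x, sub_self])
      have h2 := mul_mem h1 (hconj b hbm.1)
      convert h2 using 1
      rw [commutatorElement_def]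
      group
    · have hdisj : a.Disjoint b := by
        intro v
        by_cases hv : Agree i v y
        · exact Or.inr <| levelPerm_cylinder_apply_of_not_agree (m := i) (by omega)
            fun h => hyz (hv.symm.trans h)
        · exact Or.inl (levelPerm_cylinder_apply_of_not_agree le_rfl hv)
      rw [commutatorElement_eq_one_iff_commute.2 hdisj.commute]
      exact one_mem N
  refine commutator_levelKer_le_of_cylinder hN fun j l hj hl y z => ?_
  rcases hj.lt_or_eq with hj | hj
  · rcases hl.lt_or_eq with hl | hl
    · exact hstep (Subgroup.commutator_mem_commutator (levelPerm_mem_levelKer hj _ _)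
        (levelPerm_mem_levelKer hl _ _))
    · obtain rfl : i = l := Fin.ext hl
      rw [← inv_mem_iff, commutatorElement_inv]
      exact hmixed j hj z y
  · obtain rfl : i = j := Fin.ext hj
    rcases hl.lt_or_eq with hl | hl
    · exact hmixed l hl y z
    · obtain rfl : i = l := Fin.ext hl
      rw [commutatorElement_eq_one_iff_mul_comm.2]
      · exact one_mem N
      · rw [levelPerm_mul, levelPerm_mul]
        congr 1
        exact add_comm _ _

end Normal

/-! ### Translation invariant subspaces of function spaces -/

section LinearAlgebra

/-- The inclusion of the families of constants into the families of functions on `Y`. -/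
def constMap (p : ℕ) (ι Y : Type*) : (ι → ZMod p) →ₗ[ZMod p] (ι → Y → ZMod p) where
  toFun c j _ := c j
  map_add' _ _ := rfl
  map_smul' _ _ := rfl

lemma constMap_apply {p : ℕ} {ι Y : Type*} (c : ι → ZMod p) (j : ι) (y : Y) : constMap p ι Y c j y = c j := rfl

variable [Fact p.Prime] {ι : Type*} {Y : Type*}

/-- The families indexed by `ι` that vanish outside `J`. -/
def supportedOn (p : ℕ) [Fact p.Prime] (M : Type*) [AddCommGroup M] [Module (ZMod p) M]
    (J : Finset ι) : Submodule (ZMod p) (ι → M) where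
  carrier := {f | ∀ j ∉ J, f j = 0}
  zero_mem' := fun _ _ => rfl
  add_mem' := fun hf hg j hj => by simp [hf j hj, hg j hj]
  smul_mem' := fun c f hf j hj => by simp [hf j hj]

lemma finrank_supportedOn [DecidableEq ι] (M : Type*) [AddCommGroup M] [Module (ZMod p) M]
    [Module.Finite (ZMod p) M] (J : Finset ι) :
    Module.finrank (ZMod p) (supportedOn p M J) = J.card * Module.finrank (ZMod p) M := by
  let e : supportedOn p M J ≃ₗ[ZMod p] (J → M) :=
    { toFun := fun f j => f.1 j
      invFun := fun g => ⟨fun j => if h : j ∈ J then g ⟨j, h⟩ else 0, fun j hj => by simp [hj]⟩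
      map_add' := fun _ _ => rfl
      map_smul' := fun _ _ => rfl
      left_inv := fun f => by
        ext j
        by_cases h : j ∈ J
        · simp [h]
        · simp [h, f.2 j h]
      right_inv := fun g => by
        funext j
        simp }
  rw [e.finrank_eq, Module.finrank_pi_fintype]
  simp

lemma mem_sup_supportedOn_erase [DecidableEq ι] {W : Submodule (ZMod p) (ι → ZMod p)}
    {S : Finset ι} (hS : W ⊔ supportedOn p (ZMod p) S = ⊤) {j : ι} {w : ι → ZMod p}
    (hw : w ∈ W) (hwj : w j ≠ 0) (hws : w ∈ supportedOn p (ZMod p) (insert j S)) :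
    W ⊔ supportedOn p (ZMod p) (S.erase j) = ⊤ := by
  rw [eq_top_iff, ← hS, sup_le_iff]
  refine ⟨le_sup_left, fun f hf => ?_⟩
  have h1 : f = (f j / w j) • w + (f - (f j / w j) • w) := by abel
  rw [h1]
  refine add_mem (Submodule.mem_sup_left (W.smul_mem _ hw)) (Submodule.mem_sup_right ?_)
  intro k hk
  by_cases hkj : k = j
  · subst hkj
    simp [hwj]
  · have hkS : k ∉ S := fun h => hk (Finset.mem_erase.2 ⟨hkj, h⟩)
    simp [hf k hkS, hws k (by simp [hkj, hkS])]

/-- Steinitz exchange: a subspace that is complemented up to sums by the coordinate subspace of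
`S` has a coordinate subspace of a subset of `S` as a complement. -/
lemma exists_isCompl_supportedOn [DecidableEq ι] {W : Submodule (ZMod p) (ι → ZMod p)}
    (S : Finset ι) (hS : W ⊔ supportedOn p (ZMod p) S = ⊤) :
    ∃ J ⊆ S, IsCompl W (supportedOn p (ZMod p) J) := by
  induction S using Finset.strongInduction with
  | H S ih =>
    by_cases hdisj : W ⊓ supportedOn p (ZMod p) S = ⊥
    · exact ⟨S, subset_rfl, disjoint_iff.2 hdisj, codisjoint_iff.2 hS⟩
    · obtain ⟨w, ⟨hw1, hw2⟩, hw0⟩ := Submodule.exists_mem_ne_zero_of_ne_bot hdisj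
      obtain ⟨j, hj⟩ := Function.ne_iff.1 hw0
      have hjS : j ∈ S := by
        by_contra h
        exact hj (hw2 j h)
      obtain ⟨J, hJ, hJ'⟩ := ih (S.erase j) (Finset.erase_ssubset hjS)
        (mem_sup_supportedOn_erase hS hw1 hj (by rwa [Finset.insert_eq_of_mem hjS]))
      exact ⟨J, hJ.trans (Finset.erase_subset _ _), hJ'⟩

lemma supportedOn_univ [Fintype ι] (M : Type*) [AddCommGroup M] [Module (ZMod p) M] :
    supportedOn p M (Finset.univ : Finset ι) = ⊤ :=
  eq_top_iff.2 fun _ _ j hj => absurd (Finset.mem_univ j) hj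

/-- A vector of `W` with a non-zero `j`-th coordinate allows to complement `W` by a coordinate
subspace that does not involve the `j`-th coordinate. -/
lemma exists_isCompl_supportedOn_notMem [Fintype ι] [DecidableEq ι]
    {W : Submodule (ZMod p) (ι → ZMod p)} {j : ι} {w : ι → ZMod p} (hw : w ∈ W) (hwj : w j ≠ 0) :
    ∃ J : Finset ι, j ∉ J ∧ IsCompl W (supportedOn p (ZMod p) J) := by
  have h1 := mem_sup_supportedOn_erase (S := Finset.univ) (by rw [supportedOn_univ, sup_top_eq])
    hw hwj fun k hk => absurd (Finset.mem_insert_of_mem (Finset.mem_univ k)) hk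
  obtain ⟨J, hJ, hJ'⟩ := exists_isCompl_supportedOn _ h1
  exact ⟨J, fun h => Finset.notMem_erase _ _ (hJ h), hJ'⟩

variable [AddCommGroup Y]

/-- The subspace `U` of families of functions on `Y` is invariant under translations of the
argument. -/
def TranslationInvariant (U : Submodule (ZMod p) (ι → Y → ZMod p)) : Prop :=
  ∀ a : Y, ∀ f ∈ U, (fun j y => f j (y + a)) ∈ U

/-- A non-zero subspace that is invariant under the translations by a finite `p`-group contains a
non-zero family of constants: a `p`-group that acts on an `𝔽_p`-space has non-zero fixed
vectors. -/
lemma TranslationInvariant.exists_const [Finite ι] [Finite Y]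
    (hY : ∀ y : Y, p • y = 0) {U : Submodule (ZMod p) (ι → Y → ZMod p)}
    (hU : TranslationInvariant U) {f : ι → Y → ZMod p} (hf : f ∈ U) (hf0 : f ≠ 0) :
    ∃ c : ι → ZMod p, c ≠ 0 ∧ constMap p ι Y c ∈ U := by
  let _ : MulAction (Multiplicative Y) U :=
    { smul := fun a u => ⟨fun j y => u.1 j (y + a.toAdd), hU _ _ u.2⟩
      one_smul := fun u => Subtype.ext <| by
        funext j y
        exact congrArg (u.1 j) (add_zero y)
      mul_smul := fun a b u => Subtype.ext <| by
        funext j y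
        exact congrArg (u.1 j) (by rw [toAdd_mul, add_assoc]) }
  have hp : IsPGroup p (Multiplicative Y) := fun a => ⟨1, by
    rw [pow_one]
    exact congrArg Multiplicative.ofAdd (hY a.toAdd)⟩
  have hnt : Nontrivial U := ⟨⟨f, hf⟩, 0, fun h => hf0 (congrArg Subtype.val h)⟩
  have hdvd : p ∣ Nat.card U := by
    rw [Module.natCard_eq_pow_finrank (K := ZMod p) (V := U), Nat.card_zmod]
    exact dvd_pow_self p Module.finrank_pos.ne'
  have h0 : (0 : U) ∈ MulAction.fixedPoints (Multiplicative Y) U := fun _ => rfl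
  obtain ⟨b, hb, hb0⟩ := hp.exists_fixed_point_of_prime_dvd_card_of_fixed_point U hdvd h0
  have hconst : ∀ j y, b.1 j y = b.1 j 0 := by
    intro j y
    have h1 := congrArg (fun u : U => u.1 j 0) (hb (Multiplicative.ofAdd y))
    refine Eq.trans ?_ h1
    exact congrArg (b.1 j) (zero_add y).symm
  have hb' : constMap p ι Y (fun j => b.1 j 0) = b.1 := by
    funext j y
    exact (hconst j y).symm
  refine ⟨fun j => b.1 j 0, fun h => hb0 ?_, hb' ▸ b.2⟩
  refine Subtype.ext ?_
  rw [← hb', h, map_zero]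
  rfl

lemma translationInvariant_supportedOn (J : Finset ι) :
    TranslationInvariant (supportedOn p (Y → ZMod p) J) := by
  intro a f hf j hj
  funext y
  simp [hf j hj]

lemma TranslationInvariant.inf {U D : Submodule (ZMod p) (ι → Y → ZMod p)}
    (hU : TranslationInvariant U) (hD : TranslationInvariant D) : TranslationInvariant (U ⊓ D) :=
  fun a f hf => ⟨hU a f hf.1, hD a f hf.2⟩

/-- The intersection with a coordinate subspace vanishes if it contains no constants. -/
lemma TranslationInvariant.disjoint_supportedOn [Finite ι] [Finite Y]
    (hY : ∀ y : Y, p • y = 0) {U : Submodule (ZMod p) (ι → Y → ZMod p)}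
    (hU : TranslationInvariant U) {J : Finset ι}
    (h : Disjoint (U.comap (constMap p ι Y)) (supportedOn p (ZMod p) J)) :
    Disjoint U (supportedOn p (Y → ZMod p) J) := by
  rw [disjoint_iff, eq_bot_iff]
  intro f hf
  by_contra hf0
  obtain ⟨c, hc0, hc⟩ := (hU.inf (translationInvariant_supportedOn J)).exists_const hY hf hf0
  refine hc0 ?_
  have : c ∈ U.comap (constMap p ι Y) ⊓ supportedOn p (ZMod p) J :=
    ⟨hc.1, fun j hj => congrFun (hc.2 j hj) 0⟩
  rwa [disjoint_iff.1 h] at this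

/-- The constants of two complementary invariant subspaces are complementary. -/
lemma isCompl_comap_constMap {U D : Submodule (ZMod p) (ι → Y → ZMod p)}
    (hU : TranslationInvariant U) (hD : TranslationInvariant D) (h : IsCompl U D) :
    IsCompl (U.comap (constMap p ι Y)) (D.comap (constMap p ι Y)) := by
  constructor
  · rw [disjoint_iff, eq_bot_iff]
    intro c hc
    have h1 : constMap p ι Y c ∈ U ⊓ D := hc
    rw [disjoint_iff.1 h.disjoint] at h1
    funext j
    exact congrFun (congrFun ((Submodule.mem_bot _).1 h1) j) 0
  · rw [codisjoint_iff, eq_top_iff]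
    intro c _
    have h1 : constMap p ι Y c ∈ U ⊔ D := by
      rw [codisjoint_iff.1 h.codisjoint]; exact Submodule.mem_top
    obtain ⟨u, hu, d, hd, hud⟩ := Submodule.mem_sup.1 h1
    have hval : ∀ j y, u j y + d j y = c j := fun j y => congrFun (congrFun hud j) y
    -- by uniqueness of the decomposition, the components of a constant are constant
    have hu' : ∀ a : Y, (fun j y => u j (y + a)) = u := by
      intro a
      have h2 : (fun j y => u j (y + a)) - u ∈ U ⊓ D := by
        refine ⟨sub_mem (hU a u hu) hu, ?_⟩
        have e : (fun j y => u j (y + a)) - u = d - fun j y => d j (y + a) := by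
          funext j y
          have e1 := hval j (y + a)
          have e2 := hval j y
          simp only [Pi.sub_apply]
          linear_combination e1 - e2
        rw [e]
        exact sub_mem hd (hD a d hd)
      rw [disjoint_iff.1 h.disjoint] at h2
      exact sub_eq_zero.1 ((Submodule.mem_bot _).1 h2)
    have hu'' : constMap p ι Y (fun j => u j 0) = u := by
      funext j y
      rw [constMap_apply]
      have := congrFun (congrFun (hu' y) j) 0
      simpa using this.symm
    have hd'' : constMap p ι Y (fun j => d j 0) = d := by
      funext j y
      rw [constMap_apply]
      have e1 := hval j y
      have e2 := hval j 0
      have e3 := congrFun (congrFun hu'' j) y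
      rw [constMap_apply] at e3
      linear_combination e2 - e1 - e3
    refine Submodule.mem_sup.2 ⟨fun j => u j 0, ?_, fun j => d j 0, ?_, ?_⟩
    · rw [Submodule.mem_comap, hu'']; exact hu
    · rw [Submodule.mem_comap, hd'']; exact hd
    · funext j
      exact hval j 0

/-- For complementary invariant subspaces `U` and `D`, a coordinate subspace is a complement of
`U` as soon as this holds for the constants: both intersections with coordinate subspaces vanish,
and the resulting bounds for the dimensions of `U` and `D` must be sharp. -/
lemma isCompl_supportedOn_of_const [Fintype ι] [Finite Y]
    (hY : ∀ y : Y, p • y = 0) {U D : Submodule (ZMod p) (ι → Y → ZMod p)}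
    (hU : TranslationInvariant U) (hD : TranslationInvariant D) (h : IsCompl U D) {J : Finset ι}
    (hJ : IsCompl (U.comap (constMap p ι Y)) (supportedOn p (ZMod p) J)) :
    IsCompl U (supportedOn p (Y → ZMod p) J) := by
  classical
  have : Fintype Y := Fintype.ofFinite Y
  have hUD := isCompl_comap_constMap hU hD h
  obtain ⟨J', -, hJ'⟩ := exists_isCompl_supportedOn (W := D.comap (constMap p ι Y)) Finset.univ
    (by rw [supportedOn_univ, sup_top_eq])
  have dU := hU.disjoint_supportedOn hY hJ.disjoint
  have dD := hD.disjoint_supportedOn hY hJ'.disjoint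
  have e0 := Submodule.finrank_add_eq_of_isCompl hUD
  have e1 := Submodule.finrank_add_eq_of_isCompl hJ
  have e2 := Submodule.finrank_add_eq_of_isCompl hJ'
  have e3 := Submodule.finrank_add_eq_of_isCompl h
  have e4 := Submodule.finrank_add_finrank_le_of_disjoint dU
  have e5 := Submodule.finrank_add_finrank_le_of_disjoint dD
  rw [finrank_supportedOn] at e1 e2 e4 e5
  have hV : Module.finrank (ZMod p) (ι → Y → ZMod p) = Fintype.card ι * Fintype.card Y := by
    rw [Module.finrank_pi_fintype]; simp
  rw [hV] at e3 e4 e5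
  rw [Module.finrank_self, mul_one, Module.finrank_fintype_fun_eq_card] at e1 e2
  rw [Module.finrank_fintype_fun_eq_card] at e0 e4 e5
  have e6 : J.card + J'.card = Fintype.card ι := by omega
  have e7 : J.card * Fintype.card Y + J'.card * Fintype.card Y =
      Fintype.card ι * Fintype.card Y := by rw [← add_mul, e6]
  refine ⟨dU, codisjoint_iff.2 (Submodule.eq_top_of_finrank_eq ?_)⟩
  have e8 := Submodule.finrank_sup_add_finrank_inf_eq U (supportedOn p (Y → ZMod p) J)
  rw [disjoint_iff.1 dU, finrank_bot, finrank_supportedOn,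
    Module.finrank_fintype_fun_eq_card] at e8
  rw [hV]
  omega

end LinearAlgebra

/-! ### The image of a subgroup in the abelianization -/

/-- The additive group of the vectors whose coordinates vanish from the `i`-th on; it stands for
the set of prefixes of length `i`. -/
def prefixSpace (p n i : ℕ) : AddSubgroup (Fin n → ZMod p) where
  carrier := {x | ∀ k : Fin n, i ≤ k → x k = 0}
  zero_mem' := fun _ _ => rfl
  add_mem' := fun hx hy k hk => by simp [hx k hk, hy k hk]
  neg_mem' := fun hx k hk => by simp [hx k hk]

lemma trunc_mem_prefixSpace (i : ℕ) (v : Fin n → ZMod p) : trunc i v ∈ prefixSpace p n i :=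
  fun _ hk => trunc_apply_of_le v hk

lemma nsmul_prefixSpace_eq_zero (i : ℕ) (x : prefixSpace p n i) : p • x = 0 :=
  Subtype.ext <| funext fun k => by simp

/-- The abelianization map of `levelKer p n i` as a map into the families of functions on the
prefixes of length `i`, indexed by the levels `j ≥ i`. -/
noncomputable def psiFamily [NeZero p] (i : ℕ) (g : Perm (Fin n → ZMod p)) :
    {j : Fin n // i ≤ (j : ℕ)} → prefixSpace p n i → ZMod p :=
  fun j x => psi i g j x

section

variable [NeZero p] {i : ℕ}

lemma psi_eq_psiFamily (g : Perm (Fin n → ZMod p)) (j : Fin n) (hj : i ≤ j)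
    (x : Fin n → ZMod p) :
    psi i g j x = psiFamily i g ⟨j, hj⟩ ⟨trunc i x, trunc_mem_prefixSpace i x⟩ :=
  psi_congr g j (agree_trunc i x).symm

lemma psiFamily_mul {a b : Perm (Fin n → ZMod p)} (ha : a ∈ levelKer p n i)
    (hb : b ∈ levelKer p n i) : psiFamily i (a * b) = psiFamily i a + psiFamily i b := by
  funext j x
  exact psi_mul ha.1 hb j.2 x

lemma psiFamily_one : psiFamily (p := p) (n := n) i 1 = 0 := by
  funext j x
  exact psi_one i j.1 x.1

lemma psiFamily_mul_inv {a b : Perm (Fin n → ZMod p)} (ha : a ∈ levelKer p n i)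
    (hb : b ∈ levelKer p n i) : psiFamily i (a * b⁻¹) = psiFamily i a - psiFamily i b := by
  funext j x
  exact psi_mul_inv ha hb j.2 x

lemma psiFamily_conj {g k : Perm (Fin n → ZMod p)} (hg : g ∈ levelKer p n i)
    (hk : k ∈ levelKer p n i) : psiFamily i (g * k * g⁻¹) = psiFamily i k := by
  funext j x
  exact psi_conj_of_mem hg hk j.2 x

lemma psiFamily_conj_addRight {k : Perm (Fin n → ZMod p)} (hk : k ∈ levelKer p n i)
    (a : prefixSpace p n i) :
    psiFamily i (Equiv.addRight (-a.1) * k * (Equiv.addRight (-a.1))⁻¹) =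
      fun j x => psiFamily i k j (x + a) := by
  funext j x
  have h := psi_conj (addRight_mem_triGroup (-a.1)) hk j.2 (x.1 + a.1)
  simp only [Equiv.coe_addRight, add_neg_cancel_right] at h
  exact h

lemma mem_commutator_of_psiFamily_eq_zero {g : Perm (Fin n → ZMod p)}
    (hg : g ∈ levelKer p n i) (h : psiFamily i g = 0) :
    g ∈ ⁅levelKer p n i, levelKer p n i⁆ :=
  mem_commutator_of_psi_eq_zero hg fun j hj x => by rw [psi_eq_psiFamily g j hj, h]; rfl

/-- The image of `M ∩ levelKer p n i` under the abelianization map of `levelKer p n i`. -/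
noncomputable def psiImage (i : ℕ) (M : Subgroup (Perm (Fin n → ZMod p))) :
    Submodule (ZMod p) ({j : Fin n // i ≤ (j : ℕ)} → prefixSpace p n i → ZMod p) :=
  AddSubgroup.toZModSubmodule p
    { carrier := {f | ∃ g ∈ M, g ∈ levelKer p n i ∧ psiFamily i g = f}
      zero_mem' := ⟨1, one_mem _, one_mem _, psiFamily_one⟩
      add_mem' := by
        rintro _ _ ⟨a, ha, ha', rfl⟩ ⟨b, hb, hb', rfl⟩
        exact ⟨a * b, mul_mem ha hb, mul_mem ha' hb', psiFamily_mul ha' hb'⟩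
      neg_mem' := by
        rintro _ ⟨a, ha, ha', rfl⟩
        refine ⟨1 * a⁻¹, mul_mem (one_mem _) (inv_mem ha), mul_mem (one_mem _) (inv_mem ha'), ?_⟩
        rw [psiFamily_mul_inv (one_mem _) ha', psiFamily_one, zero_sub] }

end

/-- A supplement `M` of `N` realizes the translations modulo `N`, and `N` acts trivially on the
abelianization, so the image of `M` is invariant. -/
lemma translationInvariant_psiImage [Fact p.Prime] {i : ℕ}
    {N M : Subgroup (Perm (Fin n → ZMod p))} (hN : N ≤ levelKer p n i) (hM : M ≤ triGroup p n)
    (h : ∀ g ∈ triGroup p n, ∃ a ∈ N, ∃ b ∈ M, g = a * b) :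
    TranslationInvariant (psiImage i M) := by
  rintro a _ ⟨k, hk, hk', rfl⟩
  obtain ⟨b, hb, c, hc, hbc⟩ := h _ (addRight_mem_triGroup (-a.1))
  have hck := conj_mem_levelKer (hM hc) hk'
  refine ⟨c * k * c⁻¹, mul_mem (mul_mem hc hk) (inv_mem hc), hck, ?_⟩
  have e : b * c * k * (b * c)⁻¹ = b * (c * k * c⁻¹) * b⁻¹ := by group
  rw [← psiFamily_conj_addRight hk' a, hbc, e, psiFamily_conj (hN hb) hck]

lemma translationInvariant_psiImage_of_normal [Fact p.Prime] {i : ℕ}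
    {N : Subgroup (Perm (Fin n → ZMod p))} (hN : ∀ g ∈ triGroup p n, ∀ k ∈ N, g * k * g⁻¹ ∈ N) :
    TranslationInvariant (psiImage i N) := by
  rintro a _ ⟨k, hk, hk', rfl⟩
  have ht := addRight_mem_triGroup (-a.1)
  exact ⟨_, hN _ ht k hk, conj_mem_levelKer ht hk', psiFamily_conj_addRight hk' a⟩

/-! ### Disjoint systems of prefixes -/

/-- Among the coordinates of `v` from the `i`-th to the one before the `k`-th, the last one
vanishes and the other ones do not. For `k = i` the condition is empty. -/
def FirstZero (i : ℕ) (k : Fin n) (v : Fin n → ZMod p) : Prop :=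
  ∀ l : Fin n, i ≤ l → l < k → (v l = 0 ↔ (l : ℕ) + 1 = k)

lemma FirstZero.not_of_lt {i : ℕ} {j k : Fin n} (hij : i < j) (hjk : j < k)
    {v : Fin n → ZMod p} (hj : FirstZero i j v) : ¬ FirstZero i k v := by
  intro hk
  have hn : (j : ℕ) - 1 < n := by omega
  have hlt : (⟨(j : ℕ) - 1, hn⟩ : Fin n) < j := Fin.lt_def.2 (by simp; omega)
  have h1 := (hj ⟨(j : ℕ) - 1, hn⟩ (by simp; omega) hlt).2 (by simp; omega)
  have h2 := (hk ⟨(j : ℕ) - 1, hn⟩ (by simp; omega) (hlt.trans hjk)).1 h1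
  have h3 := Fin.lt_def.1 hjk
  simp only at h2
  omega

lemma FirstZero.congr {i : ℕ} {k : Fin n} {v w : Fin n → ZMod p}
    (h : ∀ l : Fin n, i ≤ l → l < k → (v l = 0 ↔ w l = 0)) :
    FirstZero i k v ↔ FirstZero i k w :=
  forall₃_congr fun l hl hlk => by rw [h l hl hlk]

section Count

variable [Fact p.Prime]

/-- The number of the prefixes of length `k` above a given prefix of length `i` that satisfy
`FirstZero i k`, as an element of `𝔽_p`. -/
noncomputable def firstZeroCount (i : ℕ) (k : Fin n) (x : Fin n → ZMod p) : ZMod p :=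
  open Classical in (((fiber i k x).filter (FirstZero i k)).card : ZMod p)

lemma firstZeroCount_dependsBelow (i : ℕ) (k : Fin n) :
    DependsBelow i (firstZeroCount (p := p) i k) := by
  intro x y h
  rw [firstZeroCount, fiber_congr _ h, firstZeroCount]

/-- The number of these prefixes is a power of `p - 1`, and so it is not divisible by `p`. -/
lemma firstZeroCount_ne_zero {i : ℕ} {k : Fin n} (hik : i ≤ k) (x : Fin n → ZMod p) :
    firstZeroCount i k x ≠ 0 := by
  classical
  let s : Fin n → Finset (ZMod p) := fun l =>
    if (l : ℕ) < i then {x l} else if l < k then (if (l : ℕ) + 1 = k then {0} else {0}ᶜ) else {0}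
  have hs : (fiber i k x).filter (FirstZero i k) = Fintype.piFinset s := by
    ext v
    rw [Finset.mem_filter, mem_fiber, Fintype.mem_piFinset]
    constructor
    · rintro ⟨⟨h1, h2⟩, h3⟩ l
      simp only [s]
      split_ifs with hl hlk hlk'
      · exact Finset.mem_singleton.2 (h1 l hl)
      · exact Finset.mem_singleton.2 ((h3 l (by omega) hlk).2 hlk')
      · simpa using fun h => hlk' ((h3 l (by omega) hlk).1 h)
      · exact Finset.mem_singleton.2 (h2 l (not_lt.1 hlk))
    · intro h
      refine ⟨⟨fun l hl => ?_, fun l hl => ?_⟩, fun l hl hlk => ?_⟩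
      · have := h l
        simpa [s, hl] using this
      · have := h l
        have h1 : ¬ (l : ℕ) < i := by omega
        have h2 : ¬ l < k := not_lt.2 hl
        simpa [s, h1, h2] using this
      · have := h l
        have h1 : ¬ (l : ℕ) < i := by omega
        by_cases h2 : (l : ℕ) + 1 = k
        · simpa [s, h1, h2, hlk] using this
        · simpa [s, h1, h2, hlk] using this
  rw [firstZeroCount, hs, Fintype.card_piFinset, Nat.cast_prod, Finset.prod_ne_zero_iff]
  intro l _
  simp only [s]
  split_ifs
  · simp
  · simp
  · rw [Finset.card_compl, ZMod.card, Finset.card_singleton,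
      Nat.cast_sub (Fact.out : p.Prime).one_le]
    simp
  · simp

end Count

/-! ### The standard complements -/

section StandardComplement

variable {i : ℕ} {J : Fin n → Prop}

/-- Above a prefix of length `i`, the permutation `g` moves just the coordinates in `J`; it changes
the `k`-th one only where `FirstZero i k` holds, and there by an amount `F k` that depends on the
prefix of length `i` alone. -/
def IsStandard (i : ℕ) (J : Fin n → Prop) (F : Fin n → (Fin n → ZMod p) → ZMod p)
    (g : Perm (Fin n → ZMod p)) : Prop :=
  ∀ v (k : Fin n), i ≤ k → g v k - v k =
    open Classical in if J k ∧ FirstZero i k v then F k v else 0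

lemma IsStandard.firstZero_iff
    (hJ : ∀ j k, J j → J k → i ≤ (j : ℕ) → j < k →
      ∀ v : Fin n → ZMod p, FirstZero i j v → ¬ FirstZero i k v)
    {F : Fin n → (Fin n → ZMod p) → ZMod p} {g : Perm (Fin n → ZMod p)}
    (hg : IsStandard i J F g) {k : Fin n} (hik : i ≤ k) (hk : J k) (v : Fin n → ZMod p) :
    FirstZero i k (g v) ↔ FirstZero i k v := by
  have hJ' : ∀ j k, J j → J k → i ≤ (j : ℕ) → i ≤ (k : ℕ) → j ≠ k →
      ∀ v : Fin n → ZMod p, FirstZero i j v → ¬ FirstZero i k v := by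
    intro j k hj hk hij hik hne v hv hv'
    rcases lt_or_gt_of_ne hne with h | h
    · exact hJ j k hj hk hij h v hv hv'
    · exact hJ k j hk hj hik h v hv' hv
  by_cases hex : ∃ l : Fin n, i ≤ l ∧ J l ∧ FirstZero i l v
  · -- only the `l`-th of the coordinates from the `i`-th on is moved
    obtain ⟨l, hil, hl, hlv⟩ := hex
    have h1 : ∀ m : Fin n, i ≤ m → m ≠ l → g v m = v m := by
      intro m him hml
      have h2 := hg v m him
      rw [if_neg fun h => hJ' l m hl h.1 hil him hml.symm v hlv h.2] at h2
      exact sub_eq_zero.1 h2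
    have h2 : FirstZero i l (g v) :=
      (FirstZero.congr fun m him hml => by rw [h1 m him hml.ne]).2 hlv
    by_cases hkl : k = l
    · subst hkl
      exact ⟨fun _ => hlv, fun _ => h2⟩
    · exact ⟨fun h => absurd h (hJ' l k hl hk hil hik (Ne.symm hkl) _ h2),
        fun h => absurd h (hJ' l k hl hk hil hik (Ne.symm hkl) _ hlv)⟩
  · refine FirstZero.congr fun m him _ => ?_
    have h2 := hg v m him
    rw [if_neg fun h => hex ⟨m, him, h⟩] at h2
    rw [sub_eq_zero.1 h2]

/-- The triangular permutations that are standard for some functions of the prefixes of length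
`i`, provided that the sets of the prefixes satisfying `FirstZero i k` for `k` in `J` are disjoint.
It is the wreath product of an elementary abelian group, whose rank is the number of `k ≥ i` in `J`,
with the group of the action on the first `i` coordinates. -/
def standardComplement (p n i : ℕ) (J : Fin n → Prop)
    (hJ : ∀ j k, J j → J k → i ≤ (j : ℕ) → j < k →
      ∀ v : Fin n → ZMod p, FirstZero i j v → ¬ FirstZero i k v) :
    Subgroup (Perm (Fin n → ZMod p)) where
  carrier := {g | g ∈ triGroup p n ∧ ∃ F : Fin n → (Fin n → ZMod p) → ZMod p,
    (∀ k, DependsBelow i (F k)) ∧ IsStandard i J F g}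
  one_mem' := ⟨one_mem _, 0, fun _ => DependsBelow.zero _, fun v k _ => by simp⟩
  mul_mem' := by
    rintro a b ⟨ha, F, hF, haF⟩ ⟨hb, G, hG, hbG⟩
    refine ⟨mul_mem ha hb, fun k v => F k (b v) + G k v,
      fun k v w h => by
        have h1 := hF k _ _ ((agree_apply_iff hb).2 h)
        have h2 := hG k _ _ h
        simp only [h1, h2], fun v k hk => ?_⟩
    have h1 := haF (b v) k hk
    have h2 := hbG v k hk
    have h3 : (a * b) v k - v k = (a (b v) k - b v k) + (b v k - v k) := by
      rw [Perm.mul_apply]; ring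
    rw [h3, h1, h2]
    by_cases hJk : J k
    · rw [hbG.firstZero_iff hJ hk hJk]
      split_ifs <;> simp
    · simp [hJk]
  inv_mem' := by
    rintro a ⟨ha, F, hF, haF⟩
    refine ⟨inv_mem ha, fun k v => - F k (a⁻¹ v),
      fun k v w h => by
        have h1 := hF k _ _ ((agree_apply_iff (inv_mem ha)).2 h)
        simp only [h1], fun v k hk => ?_⟩
    obtain ⟨w, rfl⟩ := a.surjective v
    have h1 := haF w k hk
    have h2 : a⁻¹ (a w) = w := a.symm_apply_apply w
    rw [h2, ← neg_sub, h1]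
    by_cases hJk : J k
    · rw [haF.firstZero_iff hJ hk hJk]
      split_ifs <;> simp
    · simp [hJk]

variable {hJ : ∀ j k, J j → J k → i ≤ (j : ℕ) → j < k →
      ∀ v : Fin n → ZMod p, FirstZero i j v → ¬ FirstZero i k v}

lemma diag_conj_mem_standardComplement (c : Fin n → (ZMod p)ˣ) {g : Perm (Fin n → ZMod p)}
    (hg : g ∈ standardComplement p n i J hJ) :
    diagHom p n c * g * (diagHom p n c)⁻¹ ∈ standardComplement p n i J hJ := by
  obtain ⟨hg, F, hF, hgF⟩ := hg
  refine ⟨diag_conj_mem hg, fun k v => c k * F k ((diagHom p n c)⁻¹ v),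
    fun k v w h => by
      have h1 := hF k _ _ (agree_diagHom_inv (c := c) h)
      simp only [h1], fun v k hk => ?_⟩
  rw [diag_conj_displacement, hgF _ k hk]
  have h1 : FirstZero i k ((diagHom p n c)⁻¹ v) ↔ FirstZero i k v :=
    FirstZero.congr fun l _ _ => by rw [diagHom_inv_apply]; simp
  rw [h1]
  split_ifs <;> simp

variable [Fact p.Prime]

lemma IsStandard.psi_eq {F : Fin n → (Fin n → ZMod p) → ZMod p} (hF : ∀ k, DependsBelow i (F k))
    {g : Perm (Fin n → ZMod p)} (hg : IsStandard i J F g) {k : Fin n} (hik : i ≤ k)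
    (x : Fin n → ZMod p) :
    psi i g k x = open Classical in if J k then firstZeroCount i k x * F k x else 0 := by
  classical
  rw [psi, Finset.sum_congr rfl fun v _ => hg v k hik]
  by_cases hk : J k
  · simp only [hk, true_and, if_true]
    rw [← Finset.sum_filter, Finset.sum_congr rfl fun v hv =>
      hF k v x (mem_fiber.1 (Finset.mem_filter.1 hv).1).1, Finset.sum_const, nsmul_eq_mul]
    rfl
  · simp [hk]

/-- Every family of functions that is supported on `J` is the image of a standard permutation. -/
lemma exists_isStandard (f : {j : Fin n // i ≤ (j : ℕ)} → prefixSpace p n i → ZMod p)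
    (hf : ∀ j, ¬ J j.1 → f j = 0) :
    ∃ g ∈ levelKer p n i, (∃ F : Fin n → (Fin n → ZMod p) → ZMod p,
      (∀ k, DependsBelow i (F k)) ∧ IsStandard i J F g) ∧ psiFamily i g = f := by
  classical
  let F : Fin n → (Fin n → ZMod p) → ZMod p := fun k v =>
    if h : i ≤ k then
      (firstZeroCount i k v)⁻¹ * f ⟨k, h⟩ ⟨trunc i v, trunc_mem_prefixSpace i v⟩ else 0
  have hF : ∀ k, DependsBelow i (F k) := by
    intro k v w h
    simp only [F]
    split_ifs with hk
    · rw [firstZeroCount_dependsBelow i k v w h]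
      congr 3
      exact trunc_congr h
    · rfl
  let D : Fin n → (Fin n → ZMod p) → ZMod p := fun k v =>
    if i ≤ k ∧ J k ∧ FirstZero i k v then F k v else 0
  have hD : ∀ k : Fin n, DependsBelow k (D k) := by
    intro k v w h
    simp only [D]
    by_cases hk : i ≤ (k : ℕ)
    · have h1 : FirstZero i k v ↔ FirstZero i k w := FirstZero.congr fun l _ hl => by rw [h l hl]
      rw [h1, hF k v w (h.mono hk)]
    · simp [hk]
  have hst : IsStandard i J F (triPerm D hD) := by
    intro v k hk
    simp [D, hk]
  refine ⟨triPerm D hD, ⟨triPerm_mem D hD, fun v k hk => ?_⟩, ⟨F, hF, hst⟩, ?_⟩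
  · have : ¬ i ≤ (k : ℕ) := by omega
    simp [D, this]
  · funext ⟨k, hk⟩ ⟨x, hx⟩
    change psi i _ k x = _
    rw [hst.psi_eq hF hk]
    split_ifs with hJk
    · simp only [F, dif_pos hk]
      rw [mul_inv_cancel_left₀ (firstZeroCount_ne_zero hk x)]
      congr 2
      exact trunc_eq_self hx
    · rw [hf ⟨k, hk⟩ hJk]; rfl

lemma psiImage_levelKer : psiImage (p := p) i (levelKer p n i) = ⊤ := by
  rw [eq_top_iff]
  intro f _
  obtain ⟨g, hg, -, hgf⟩ := exists_isStandard (J := fun _ => True) f fun _ h => absurd trivial h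
  exact ⟨g, hg, hg, hgf⟩

/-- A coordinate subspace that complements the image of the normal subgroup `N` lifts to a
complement of `N`. -/
lemma isComplement_standardComplement {N : Subgroup (Perm (Fin n → ZMod p))}
    (hN : N ≤ levelKer p n i) (hker : ⁅levelKer p n i, levelKer p n i⁆ ≤ N)
    {S : Finset {j : Fin n // i ≤ (j : ℕ)}} (hS : ∀ j, J j.1 ↔ j ∈ S)
    (hcompl : IsCompl (psiImage i N) (supportedOn p (prefixSpace p n i → ZMod p) S)) :
    N ⊓ standardComplement p n i J hJ = ⊥ ∧
      ∀ g ∈ triGroup p n, ∃ a ∈ N, ∃ b ∈ standardComplement p n i J hJ, g = a * b := by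
  classical
  constructor
  · rw [eq_bot_iff]
    rintro g ⟨hgN, hg, F, hF, hgF⟩
    have h1 : psiFamily i g ∈ psiImage i N ⊓ supportedOn p (prefixSpace p n i → ZMod p) S := by
      refine ⟨⟨g, hgN, hN hgN, rfl⟩, fun j hj => ?_⟩
      funext x
      change psi i g j x = 0
      rw [hgF.psi_eq hF j.2, if_neg fun h => hj ((hS j).1 h)]
    rw [disjoint_iff.1 hcompl.disjoint, Submodule.mem_bot] at h1
    rw [Subgroup.mem_bot]
    refine Equiv.ext fun v => funext fun k => ?_
    rw [Perm.one_apply]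
    by_cases hk : i ≤ (k : ℕ)
    · rw [← sub_eq_zero, hgF v k hk]
      split_ifs with hJk
      · have h2 := hgF.psi_eq hF hk v
        rw [if_pos hJk.1, psi_eq_psiFamily g k hk, h1] at h2
        exact (mul_eq_zero.1 h2.symm).resolve_left (firstZeroCount_ne_zero hk v)
      · rfl
    · exact (hN hgN).2 v k (not_le.1 hk)
  · intro g hg
    -- the action of `g` on the prefixes of length `i`, extended trivially
    let D : Fin n → (Fin n → ZMod p) → ZMod p := fun k v => if (k : ℕ) < i then g v k - v k else 0
    have hD : ∀ k : Fin n, DependsBelow k (D k) := by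
      intro k v w h
      simp only [D]
      split_ifs
      · exact hg k v w h
      · rfl
    have ht : triPerm D hD ∈ standardComplement p n i J hJ := by
      refine ⟨triPerm_mem D hD, 0, fun _ => DependsBelow.zero _, fun v k hk => ?_⟩
      simp [D, hk]
    have hgt : g * (triPerm D hD)⁻¹ ∈ levelKer p n i := by
      refine ⟨mul_mem hg (inv_mem ht.1), fun v k hk => ?_⟩
      obtain ⟨w, rfl⟩ := (triPerm D hD).surjective v
      rw [Perm.mul_apply, Perm.inv_def, Equiv.symm_apply_apply]
      simp [D, hk]
    have h1 : psiFamily i (g * (triPerm D hD)⁻¹) ∈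
        psiImage i N ⊔ supportedOn p (prefixSpace p n i → ZMod p) S := by
      rw [codisjoint_iff.1 hcompl.codisjoint]; exact Submodule.mem_top
    obtain ⟨_, ⟨m, hmN, hm, rfl⟩, f, hf, hsum⟩ := Submodule.mem_sup.1 h1
    obtain ⟨e, he, ⟨F, hF, heF⟩, hef⟩ := exists_isStandard (J := J) f fun j hj =>
      hf j fun h => hj ((hS j).2 h)
    have heC : e ∈ standardComplement p n i J hJ := ⟨he.1, F, hF, heF⟩
    have h2 : g * (triPerm D hD)⁻¹ * e⁻¹ * m⁻¹ ∈ N := by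
      have h3 := mul_mem hgt (inv_mem he)
      refine hker (mem_commutator_of_psiFamily_eq_zero (mul_mem h3 (inv_mem hm)) ?_)
      rw [psiFamily_mul_inv h3 hm, psiFamily_mul_inv hgt he, hef, ← hsum]
      abel
    refine ⟨g * (triPerm D hD)⁻¹ * e⁻¹, ?_, e * triPerm D hD, mul_mem heC ht, by group⟩
    simpa using mul_mem h2 hmN

end StandardComplement

variable [Fact p.Prime]

/-! ### Complemented normal subgroups -/

lemma fiber_self (i : ℕ) (x : Fin n → ZMod p) : fiber i i x = {trunc i x} := by
  ext v
  rw [mem_fiber, Finset.mem_singleton]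
  constructor
  · rintro ⟨h1, h2⟩
    rw [← trunc_congr h1, trunc_eq_self h2]
  · rintro rfl
    exact ⟨agree_trunc i x, fun k hk => trunc_apply_of_le x hk⟩

lemma psi_self (i : Fin n) {g : Perm (Fin n → ZMod p)} (hg : g ∈ triGroup p n)
    (x : Fin n → ZMod p) : psi i g i x = g x i - x i := by
  rw [psi, fiber_self, Finset.sum_singleton]
  exact hg i _ _ (agree_trunc i x)

/-- A normal subgroup that acts trivially on the first `i` coordinates but not on the `i`-th one
contains an element that adds `1` to the `i`-th coordinate of every vector. -/
lemma exists_mem_add_one {i : Fin n} {N : Subgroup (Perm (Fin n → ZMod p))}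
    (hN : ∀ g ∈ triGroup p n, ∀ k ∈ N, g * k * g⁻¹ ∈ N) (hNi : N ≤ levelKer p n i)
    (hNi' : ¬ N ≤ levelKer p n (i + 1)) : ∃ g ∈ N, ∀ v, g v i = v i + 1 := by
  obtain ⟨g₀, hg₀, hg₀'⟩ := SetLike.not_le_iff_exists.1 hNi'
  let proj : ({j : Fin n // (i : ℕ) ≤ (j : ℕ)} → prefixSpace p n i → ZMod p) →ₗ[ZMod p]
      (Unit → prefixSpace p n i → ZMod p) :=
    { toFun := fun f _ => f ⟨i, le_rfl⟩
      map_add' := fun _ _ => rfl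
      map_smul' := fun _ _ => rfl }
  have hU : TranslationInvariant ((psiImage i N).map proj) := by
    rintro a _ ⟨f, hf, rfl⟩
    exact ⟨_, translationInvariant_psiImage_of_normal hN a f hf, rfl⟩
  have hf0 : proj (psiFamily i g₀) ≠ 0 := by
    intro h
    refine hg₀' (mem_levelKer_succ (hNi hg₀) fun v => ?_)
    have h1 : psiFamily i g₀ ⟨i, le_rfl⟩ = 0 := congrFun h ()
    have h2 := psi_eq_psiFamily g₀ i le_rfl v
    rw [h1, psi_self i (hNi hg₀).1] at h2
    exact sub_eq_zero.1 h2
  obtain ⟨c, hc0, _, ⟨g, hg, hg', rfl⟩, hgc⟩ :=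
    hU.exists_const (nsmul_prefixSpace_eq_zero i) ⟨_, ⟨g₀, hg₀, hNi hg₀, rfl⟩, rfl⟩ hf0
  have hc : c () ≠ 0 := fun h => hc0 (funext fun _ => h)
  have hgv : ∀ v, g v i - v i = c () := by
    intro v
    rw [← psi_self i hg'.1, psi_eq_psiFamily g i le_rfl]
    exact congrFun (congrFun hgc ()) _
  refine ⟨g ^ ((c ())⁻¹).val, pow_mem hg _, fun v => ?_⟩
  rw [pow_apply_level hg', hgv, ZMod.natCast_zmod_val, inv_mul_cancel₀ hc]

/-- Prefixes of length `j` above a prefix of length `i` can be sorted by their `i`-th entry. -/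
lemma psi_eq_sum_psi_succ (i j : Fin n) (g : Perm (Fin n → ZMod p))
    (x : Fin n → ZMod p) :
    psi i g j x = ∑ t : ZMod p, psi (i + 1) g j (Function.update x i t) := by
  classical
  rw [psi, ← Finset.sum_fiberwise (s := fiber i j x) (g := fun v => v i)]
  refine Finset.sum_congr rfl fun t _ => ?_
  rw [psi]
  refine Finset.sum_congr ?_ fun _ _ => rfl
  ext v
  rw [Finset.mem_filter, mem_fiber, mem_fiber]
  have hupd : Agree i (Function.update x i t) x := fun k hk => by
    have : k ≠ i := fun h => by simp [h] at hk
    simp [this]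
  constructor
  · rintro ⟨⟨h1, h2⟩, h3⟩
    exact ⟨(h1.trans hupd.symm).succ (by simp [h3]), h2⟩
  · rintro ⟨h1, h2⟩
    exact ⟨⟨(h1.mono (Nat.le_succ _)).trans hupd, h2⟩, by simpa using h1 i (by simp)⟩

/-- If `d` translates the `i`-th coordinate by a non-zero constant, then it permutes the values of
the `i`-th entry cyclically, and the sum of the displacements of an element `k` that commutes with
`d` vanishes, as it consists of `p` equal summands. -/
lemma psi_eq_zero_of_commute {i j : Fin n} (hij : i < j) {d k : Perm (Fin n → ZMod p)}
    (hd : d ∈ levelKer p n i) {c : ZMod p} (hc : c ≠ 0) (hdc : ∀ v, d v i = v i + c)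
    (hk : k ∈ levelKer p n (i + 1)) (hdk : d * k = k * d) (x : Fin n → ZMod p) :
    psi i k j x = 0 := by
  have hstep : ∀ t, psi (i + 1) k j (Function.update x i (t + c)) =
      psi (i + 1) k j (Function.update x i t) := by
    intro t
    have h1 := psi_conj hd.1 hk (j := j) hij (Function.update x i t)
    rw [hdk, mul_inv_cancel_right] at h1
    rw [← h1]
    refine psi_congr _ _ (Agree.succ ?_ ?_)
    · refine Agree.trans (fun l hl => ?_) (hd.2 _).symm
      have : l ≠ i := fun h => by simp [h] at hl
      simp [this]
    · rw [hdc]; simp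
  have hiter : ∀ m : ℕ, psi (i + 1) k j (Function.update x i (m * c)) =
      psi (i + 1) k j (Function.update x i 0) := by
    intro m
    induction m with
    | zero => simp
    | succ m ih => rw [Nat.cast_succ, add_mul, one_mul, hstep, ih]
  have hall : ∀ t, psi (i + 1) k j (Function.update x i t) =
      psi (i + 1) k j (Function.update x i 0) := by
    intro t
    rw [← hiter (t / c).val, ZMod.natCast_zmod_val, div_mul_cancel₀ _ hc]
  rw [psi_eq_sum_psi_succ i j, Finset.sum_congr rfl fun t _ => hall t, Finset.sum_const,
    Finset.card_univ, ZMod.card]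
  simp

/-- A complement of `N` in the triangular group induces a complement of its image in the
abelianization of `levelKer p n i`. -/
lemma isCompl_psiImage {i : ℕ} {N L : Subgroup (Perm (Fin n → ZMod p))}
    (hNi : N ≤ levelKer p n i) (hker : ⁅levelKer p n i, levelKer p n i⁆ ≤ N)
    (hNL : N ⊓ L = ⊥) (hLP : ∀ g ∈ triGroup p n, ∃ a ∈ N, ∃ b ∈ L, g = a * b) :
    IsCompl (psiImage i N) (psiImage i L) := by
  constructor
  · rw [disjoint_iff, eq_bot_iff]
    rintro _ ⟨⟨a, ha, ha', rfl⟩, b, hb, hb', hab⟩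
    have h1 : a * b⁻¹ ∈ N := hker (mem_commutator_of_psiFamily_eq_zero
      (mul_mem ha' (inv_mem hb')) (by rw [psiFamily_mul_inv ha' hb', hab, sub_self]))
    have h2 : b ∈ N ⊓ L := by
      refine ⟨?_, hb⟩
      have := mul_mem (inv_mem h1) ha
      simpa using this
    rw [hNL, Subgroup.mem_bot] at h2
    rw [Submodule.mem_bot, ← hab, h2, psiFamily_one]
  · rw [codisjoint_iff, eq_top_iff, ← psiImage_levelKer]
    rintro _ ⟨g, hg, -, rfl⟩
    obtain ⟨a, ha, b, hb, rfl⟩ := hLP g hg.1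
    have hb' : b ∈ levelKer p n i := by simpa using mul_mem (inv_mem (hNi ha)) hg
    rw [psiFamily_mul (hNi ha) hb']
    exact Submodule.add_mem_sup ⟨a, ha, hNi ha, rfl⟩ ⟨b, hb, hb', rfl⟩

/-- There is a coordinate complement of the constants in the image of `N` that either avoids the
`i`-th coordinate or has at most one element. If no constant in the image of `N` involves the
`i`-th coordinate, then some element of the complement `L` translates this coordinate. Since
`L ∩ levelKer p n i` is abelian, the constants in its image form a space of dimension at most
one. -/
lemma exists_coordinates {i : Fin n} {N L : Subgroup (Perm (Fin n → ZMod p))}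
    (hker : ⁅levelKer p n i, levelKer p n i⁆ ≤ N) (hNL : N ⊓ L = ⊥)
    (hU : TranslationInvariant (psiImage i N)) (hD : TranslationInvariant (psiImage i L)) (hUD : IsCompl (psiImage i N) (psiImage i L)) :
    ∃ S : Finset {j : Fin n // (i : ℕ) ≤ (j : ℕ)},
      IsCompl ((psiImage i N).comap (constMap p _ _)) (supportedOn p (ZMod p) S) ∧
      (⟨i, le_rfl⟩ ∉ S ∨ S.card ≤ 1) := by
  classical
  by_cases hex : ∃ w ∈ (psiImage i N).comap (constMap p _ _),
      w (⟨i, le_rfl⟩ : {j : Fin n // (i : ℕ) ≤ (j : ℕ)}) ≠ 0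
  · obtain ⟨w, hw, hwi⟩ := hex
    obtain ⟨S, hS, hS'⟩ := exists_isCompl_supportedOn_notMem hw hwi
    exact ⟨S, hS', Or.inl hS⟩
  push Not at hex
  have hconst := isCompl_comap_constMap hU hD hUD
  obtain ⟨S, -, hS⟩ := exists_isCompl_supportedOn (p := p)
    (W := (psiImage i N).comap (constMap p _ _)) Finset.univ (by rw [supportedOn_univ, sup_top_eq])
  refine ⟨S, hS, Or.inr ?_⟩
  have hcard : S.card =
      Module.finrank (ZMod p) ((psiImage i L).comap (constMap p _ _)) := by
    have e1 := Submodule.finrank_add_eq_of_isCompl hS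
    have e2 := Submodule.finrank_add_eq_of_isCompl hconst
    rw [finrank_supportedOn, Module.finrank_self, mul_one] at e1
    omega
  rw [hcard]
  obtain ⟨d, hd, hdi⟩ : ∃ d ∈ (psiImage i L).comap (constMap p _ _),
      d (⟨i, le_rfl⟩ : {j : Fin n // (i : ℕ) ≤ (j : ℕ)}) ≠ 0 := by
    have h1 : (fun _ => 1 : {j : Fin n // (i : ℕ) ≤ (j : ℕ)} → ZMod p) ∈
        (psiImage i N).comap (constMap p _ _) ⊔ (psiImage i L).comap (constMap p _ _) := by
      rw [codisjoint_iff.1 hconst.codisjoint]; exact Submodule.mem_top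
    obtain ⟨u, hu, d, hd, hud⟩ := Submodule.mem_sup.1 h1
    refine ⟨d, hd, ?_⟩
    have h2 := congrFun hud ⟨i, le_rfl⟩
    rw [Pi.add_apply, hex u hu, zero_add] at h2
    rw [h2]
    exact one_ne_zero
  have hval : ∀ {l : Perm (Fin n → ZMod p)} {w : {j : Fin n // (i : ℕ) ≤ (j : ℕ)} → ZMod p},
      l ∈ levelKer p n i → psiFamily i l = constMap p _ _ w →
      ∀ v, l v i = v i + w ⟨i, le_rfl⟩ := by
    intro l w hl h v
    have h1 := psi_self i hl.1 v
    rw [psi_eq_psiFamily l i le_rfl, h, constMap_apply] at h1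
    rw [h1]; ring
  obtain ⟨l, hl, hl', hld⟩ := hd
  have hzero : ∀ w ∈ (psiImage i L).comap (constMap p _ _),
      w (⟨i, le_rfl⟩ : {j : Fin n // (i : ℕ) ≤ (j : ℕ)}) = 0 → w = 0 := by
    rintro w ⟨k, hk, hk', hkw⟩ hwi
    have hcomm : l * k = k * l := by
      have h1 : ⁅l, k⁆ ∈ N ⊓ L :=
        ⟨hker (Subgroup.commutator_mem_commutator hl' hk'),
          L.mul_mem (L.mul_mem (L.mul_mem hl hk) (L.inv_mem hl)) (L.inv_mem hk)⟩
      rw [hNL, Subgroup.mem_bot] at h1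
      exact commutatorElement_eq_one_iff_mul_comm.1 h1
    have hk'' : k ∈ levelKer p n (i + 1) :=
      mem_levelKer_succ hk' fun v => by rw [hval hk' hkw, hwi, add_zero]
    funext ⟨j, hj⟩
    rcases hj.lt_or_eq with hj' | hj'
    · have h1 := psi_eq_zero_of_commute hj' hl' hdi (hval hl' hld) hk'' hcomm 0
      rw [psi_eq_psiFamily k j hj, hkw, constMap_apply] at h1
      exact h1
    · obtain rfl : i = j := Fin.ext hj'
      exact hwi
  refine finrank_le_one (⟨d, l, hl, hl', hld⟩ : (psiImage i L).comap (constMap p _ _)) fun w => ?_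
  refine ⟨w.1 ⟨i, le_rfl⟩ / d ⟨i, le_rfl⟩, Subtype.ext ?_⟩
  rw [eq_comm, ← sub_eq_zero]
  have hd : d ∈ (psiImage i L).comap (constMap p _ _) := ⟨l, hl, hl', hld⟩
  refine hzero _ (sub_mem w.2 (Submodule.smul_mem _ _ hd)) ?_
  simp [hdi]

/-- Every complemented normal subgroup of the triangular group has a complement that is invariant
under all diagonal matrices. -/
theorem exists_invariant_complement {N L : Subgroup (Perm (Fin n → ZMod p))}
    (hNP : N ≤ triGroup p n) (hLP : L ≤ triGroup p n)
    (hN : ∀ g ∈ triGroup p n, ∀ k ∈ N, g * k * g⁻¹ ∈ N) (hNL : N ⊓ L = ⊥)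
    (hmul : ∀ g ∈ triGroup p n, ∃ a ∈ N, ∃ b ∈ L, g = a * b) :
    ∃ C ≤ triGroup p n, N ⊓ C = ⊥ ∧ (∀ g ∈ triGroup p n, ∃ a ∈ N, ∃ b ∈ C, g = a * b) ∧
      ∀ c, ∀ g ∈ C, diagHom p n c * g * (diagHom p n c)⁻¹ ∈ C := by
  classical
  by_cases hbot : N ≤ levelKer p n n
  · have hN1 : N = ⊥ := eq_bot_iff.2 fun g hg => eq_one_of_mem_levelKer le_rfl (hbot hg)
    exact ⟨triGroup p n, le_rfl, by rw [hN1, bot_inf_eq],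
      fun g hg => ⟨1, one_mem _, g, hg, (one_mul g).symm⟩, fun c g hg => diag_conj_mem hg⟩
  -- the first coordinate on which `N` acts non-trivially
  obtain ⟨i, hNi, hNi'⟩ : ∃ i : Fin n, N ≤ levelKer p n i ∧ ¬ N ≤ levelKer p n (i + 1) := by
    by_contra! h
    have : ∀ m : ℕ, m ≤ n → N ≤ levelKer p n m := by
      intro m
      induction m with
      | zero => intro _; rwa [levelKer_zero]
      | succ m ih => intro hm; exact h ⟨m, hm⟩ (ih (by omega))
    exact hbot (this n le_rfl)
  obtain ⟨g, hg, hg1⟩ := exists_mem_add_one hN hNi hNi'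
  have hker := commutator_levelKer_le (Fact.out : p.Prime).ne_one hN hg (hNi hg) hg1
  have hU : TranslationInvariant (psiImage i N) :=
    translationInvariant_psiImage_of_normal hN
  have hD : TranslationInvariant (psiImage i L) := translationInvariant_psiImage hNi hLP hmul
  have hUD := isCompl_psiImage hNi hker hNL hmul
  obtain ⟨S, hS, hScase⟩ := exists_coordinates hker hNL hU hD hUD
  have hcompl := isCompl_supportedOn_of_const (nsmul_prefixSpace_eq_zero (i : ℕ)) hU hD hUD hS
  have hJ : ∀ j k : Fin n, (∃ h : (i : ℕ) ≤ j, (⟨j, h⟩ : {j : Fin n // (i : ℕ) ≤ (j : ℕ)}) ∈ S) →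
      (∃ h : (i : ℕ) ≤ k, (⟨k, h⟩ : {j : Fin n // (i : ℕ) ≤ (j : ℕ)}) ∈ S) → (i : ℕ) ≤ (j : ℕ) →
      j < k → ∀ v : Fin n → ZMod p, FirstZero i j v → ¬ FirstZero i k v := by
    rintro j k ⟨hij, hj⟩ ⟨hik, hk⟩ _ hjk v hv
    rcases hScase with hiS | hcard
    · refine hv.not_of_lt (lt_of_le_of_ne hij fun h => hiS ?_) hjk
      have h' : i = j := Fin.ext h
      subst h'
      exact hj
    · have := Finset.card_le_one.1 hcard _ hj _ hk
      exact absurd (congrArg Subtype.val this) hjk.ne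
  have hfin := isComplement_standardComplement (hJ := hJ) hNi hker
    (fun j => ⟨fun ⟨_, h⟩ => h, fun h => ⟨j.2, h⟩⟩) hcompl
  exact ⟨standardComplement p n i _ hJ, fun g hg => hg.1, hfin.1, hfin.2,
    fun c g hg => diag_conj_mem_standardComplement c hg⟩

/-! ### Transport of structure -/

section Transport

variable {G G' : Type*} [Group G] [Group G']

/-- A form of `ComplementsCanBeInvariant` that refers to subgroups of the ambient group only. -/
def HasInvariantComplements (H P : Subgroup G) : Prop :=
  ∀ N L : Subgroup G, N ≤ P → L ≤ P → (∀ g ∈ P, ∀ k ∈ N, g * k * g⁻¹ ∈ N) → N ⊓ L = ⊥ →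
    (∀ g ∈ P, ∃ a ∈ N, ∃ b ∈ L, g = a * b) →
    ∃ C ≤ P, N ⊓ C = ⊥ ∧ (∀ g ∈ P, ∃ a ∈ N, ∃ b ∈ C, g = a * b) ∧ IsConjInvariant H C

lemma HasInvariantComplements.complementsCanBeInvariant {H P : Subgroup G}
    (h : HasInvariantComplements H P) : ComplementsCanBeInvariant H P := by
  rintro N hN ⟨L, hNL⟩
  obtain ⟨C, hCP, hC1, hC2, hC3⟩ := h (N.map P.subtype) (L.map P.subtype)
    (Subgroup.map_subtype_le N) (Subgroup.map_subtype_le L)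
    (by
      rintro g hg _ ⟨k, hk, rfl⟩
      exact ⟨⟨g, hg⟩ * k * ⟨g, hg⟩⁻¹, hN.conj_mem k hk _, rfl⟩)
    (by
      rw [← Subgroup.map_inf _ _ _ P.subtype_injective, disjoint_iff.1 hNL.disjoint,
        Subgroup.map_bot])
    (by
      intro g hg
      obtain ⟨⟨a, b⟩, hab⟩ := hNL.2 ⟨g, hg⟩
      exact ⟨a.1, ⟨a.1, a.2, rfl⟩, b.1, ⟨b.1, b.2, rfl⟩, congrArg Subtype.val hab.symm⟩)
  refine ⟨C.subgroupOf P, Subgroup.isComplement'_of_disjoint_and_mul_eq_univ ?_ ?_, ?_⟩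
  · rw [disjoint_iff, eq_bot_iff]
    rintro x ⟨hx1, hx2⟩
    have : x.1 ∈ N.map P.subtype ⊓ C := ⟨⟨x, hx1, rfl⟩, hx2⟩
    rw [hC1, Subgroup.mem_bot] at this
    exact Subtype.ext this
  · rw [Set.eq_univ_iff_forall]
    rintro ⟨g, hg⟩
    obtain ⟨_, ⟨a, ha, rfl⟩, b, hb, hab⟩ := hC2 g hg
    exact ⟨a, ha, ⟨b, hCP hb⟩, hb, Subtype.ext hab.symm⟩
  · rwa [Subgroup.map_subgroupOf_eq_of_le hCP]

lemma HasInvariantComplements.map {H P : Subgroup G} (h : HasInvariantComplements H P)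
    (e : G ≃* G') :
    HasInvariantComplements (H.map e.toMonoidHom) (P.map e.toMonoidHom) := by
  have hmap : ∀ (K : Subgroup G) {x : G}, e x ∈ K.map e.toMonoidHom ↔ x ∈ K := fun K x =>
    Subgroup.mem_map_iff_mem (f := e.toMonoidHom) e.injective
  intro N L hNP hLP hN hNL hmul
  obtain ⟨C, hCP, hC1, hC2, hC3⟩ := h (N.comap e.toMonoidHom) (L.comap e.toMonoidHom)
    (fun x hx => (hmap P).1 (hNP hx)) (fun x hx => (hmap P).1 (hLP hx))
    (by
      intro g hg k hk
      have := hN (e g) ((hmap P).2 hg) (e k) hk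
      rw [← map_inv, ← map_mul, ← map_mul] at this
      exact this)
    (by
      rw [eq_bot_iff]
      rintro x hx
      have : e x ∈ N ⊓ L := hx
      rw [hNL, Subgroup.mem_bot] at this
      exact (map_eq_one_iff e e.injective).1 this)
    (by
      intro g hg
      obtain ⟨a, ha, b, hb, hab⟩ := hmul (e g) ((hmap P).2 hg)
      obtain ⟨a, rfl⟩ := e.surjective a
      obtain ⟨b, rfl⟩ := e.surjective b
      exact ⟨a, ha, b, hb, e.injective (hab.trans (map_mul e a b).symm)⟩)
  refine ⟨C.map e.toMonoidHom, Subgroup.map_mono hCP, ?_, ?_, ?_⟩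
  · rw [eq_bot_iff]
    rintro _ ⟨hx, x, hxC, rfl⟩
    have : x ∈ N.comap e.toMonoidHom ⊓ C := ⟨hx, hxC⟩
    rw [hC1, Subgroup.mem_bot] at this
    rw [this, map_one]
    exact one_mem _
  · rintro _ ⟨g, hg, rfl⟩
    obtain ⟨a, ha, b, hb, rfl⟩ := hC2 g hg
    exact ⟨e a, ha, e b, ⟨b, hb, rfl⟩, map_mul e a b⟩
  · rintro _ ⟨x, hx, rfl⟩ _ ⟨c, hc, rfl⟩
    exact ⟨x * c * x⁻¹, hC3 x hx c hc, by simp⟩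

lemma IsHallPrimeToIn.map {p : ℕ} {H K : Subgroup G} (h : IsHallPrimeToIn p H K) (e : G ≃* G') :
    IsHallPrimeToIn p (H.map e.toMonoidHom) (K.map e.toMonoidHom) := by
  obtain ⟨hle, h1, m, hm⟩ := h
  have hle' : H.map e.toMonoidHom ≤ K.map e.toMonoidHom := Subgroup.map_mono hle
  refine ⟨hle', ?_, m, ?_⟩
  · rw [Nat.card_congr (Subgroup.subgroupOfEquivOfLe hle).toEquiv] at h1
    rw [Nat.card_congr (Subgroup.subgroupOfEquivOfLe hle').toEquiv,
      ← Nat.card_congr (H.equivMapOfInjective e.toMonoidHom e.injective).toEquiv]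
    exact h1
  · rw [← hm]
    exact Subgroup.relIndex_map_map_of_injective H K e.injective

end Transport

lemma hasInvariantComplements_triGroup :
    HasInvariantComplements (diagHom p n).range (triGroup p n) := by
  intro N L hNP hLP hN hNL hmul
  obtain ⟨C, hCP, hC1, hC2, hC3⟩ := exists_invariant_complement hNP hLP hN hNL hmul
  refine ⟨C, hCP, hC1, hC2, ?_⟩
  rintro _ ⟨c, rfl⟩ g hg
  exact hC3 c g hg

/-- Every Sylow subgroup of a symmetric group on `p ^ n` letters is the image of the triangular
group under an isomorphism of the symmetric groups. -/
lemma exists_mulEquiv_map_triGroup_eq (P : Sylow p (Perm (Fin (p ^ n)))) :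
    ∃ e : Perm (Fin n → ZMod p) ≃* Perm (Fin (p ^ n)),
      (triGroup p n).map e.toMonoidHom = P := by
  obtain ⟨P₀, hP₀⟩ := exists_sylow_eq_triGroup (p := p) (n := n)
  have hcard : Fintype.card (Fin n → ZMod p) = Fintype.card (Fin (p ^ n)) := by
    simp [ZMod.card]
  let e₀ : Perm (Fin n → ZMod p) ≃* Perm (Fin (p ^ n)) :=
    (Fintype.equivOfCardEq hcard).permCongrHom
  have hsurj : Function.Surjective e₀.toMonoidHom := e₀.surjective
  obtain ⟨g, hg⟩ := MulAction.exists_smul_eq (Perm (Fin (p ^ n)))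
    (P₀.mapSurjective hsurj) P
  refine ⟨e₀.trans (MulAut.conj g), ?_⟩
  rw [← hg, Sylow.coe_subgroup_smul, Sylow.coe_mapSurjective, hP₀]
  change _ = ((triGroup p n).map e₀.toMonoidHom).map (MulAut.conj g).toMonoidHom
  rw [Subgroup.map_map]
  rfl

end MaschkeSym

theorem theorem1p5 (p : ℕ) [Fact p.Prime] (n : ℕ) :
    -- every Sylow subgroup of the symmetric group on `p ^ n` letters
    (∀ P : Sylow p (Equiv.Perm (Fin (p ^ n))),
      ∃ H : Subgroup (Equiv.Perm (Fin (p ^ n))),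
        MaschkeSym.IsHallPrimeToIn p H
          (Subgroup.normalizer ((P : Subgroup (Equiv.Perm (Fin (p ^ n)))) : Set _)) ∧
        Nonempty (H ≃* (Fin n → Multiplicative (ZMod (p - 1)))) ∧
        MaschkeSym.ComplementsCanBeInvariant H (P : Subgroup (Equiv.Perm (Fin (p ^ n))))) ∧
    -- the explicit model on `𝔽_p ^ n`, for any generator `r` of the group of units
    (∀ r : (ZMod p)ˣ, Subgroup.zpowers r = ⊤ →
      (∃ P : Sylow p (Equiv.Perm (Fin n → ZMod p)),
        (P : Subgroup (Equiv.Perm (Fin n → ZMod p))) = MaschkeSym.sigmaGroup p n) ∧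
      MaschkeSym.IsHallPrimeToIn p (MaschkeSym.etaGroup p n r)
        (Subgroup.normalizer (MaschkeSym.sigmaGroup p n : Set _)) ∧
      Nonempty (MaschkeSym.etaGroup p n r ≃* (Fin n → Multiplicative (ZMod (p - 1)))) ∧
      MaschkeSym.ComplementsCanBeInvariant (MaschkeSym.etaGroup p n r)
        (MaschkeSym.sigmaGroup p n)) := by
  constructor
  · intro P
    obtain ⟨e, he⟩ := MaschkeSym.exists_mulEquiv_map_triGroup_eq P
    refine ⟨(MaschkeSym.diagHom p n).range.map e.toMonoidHom, ?_, ?_, ?_⟩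
    · rw [← he, ← Subgroup.map_equiv_normalizer_eq]
      exact MaschkeSym.isHallPrimeToIn_range_diagHom.map e
    · obtain ⟨f⟩ := MaschkeSym.nonempty_mulEquiv_range_diagHom (p := p) (n := n)
      exact ⟨((MaschkeSym.diagHom p n).range.equivMapOfInjective e.toMonoidHom
        e.injective).symm.trans f⟩
    · rw [← he]
      exact (MaschkeSym.hasInvariantComplements_triGroup.map e).complementsCanBeInvariant
  · intro r hr
    rw [MaschkeSym.etaGroup_eq_range r hr, MaschkeSym.sigmaGroup_eq_triGroup]
    exact ⟨MaschkeSym.exists_sylow_eq_triGroup, MaschkeSym.isHallPrimeToIn_range_diagHom,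
      MaschkeSym.nonempty_mulEquiv_range_diagHom,
      MaschkeSym.hasInvariantComplements_triGroup.complementsCanBeInvariant⟩
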